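/- Let $p\ge 1$. A $p$-watermelon (without wall) of length $2n$ is a family of $p$ lattice paths in $\mathbb{Z}^2$ with steps $(1,1)$ and $(1,-1)$, the $i$-th path ($0\le i<p$) running from $(0,2i)$ to $(2n,2i)$, such that no two of the paths share a lattice point. Let $R_{n,p}$ be the range of a uniformly random $p$-watermelon of length $2n$, that is, the maximal ordinate of its topmost path minus the minimal ordinate of its bottommost path. Let $H_a$ denote the (physicists') Hermite polynomials, $H_0=1$, $H_{a+1}(x)=2xH_a(x)-H_a'(x)$, and for $z>0$, $w\in\mathbb{R}$ put \[ T_p(z,w)=\det_{0\le i,j<p}\left((-1)^i\sum_{\ell\in\mathbb{Z}}H_{i+j}(\ell z)e^{-(\ell z)^2}-\sum_{\ell\in\mathbb{Z}}H_{i+j}(\ell z+w)e^{-(\ell z+w)^2}\right). \] These series converge absolutely for $z>0$. For each fixed $t\in(0,\infty)$, the function $z\mapsto T_p(z,w)$ is differentiable at $z=t$ for every $w\in\mathbb{R}$, the derivative $\left.\frac{\partial}{\partial z}T_p(z,w)\right|_{z=t}$ is integrable in $w$ over $[0,t]$, and \[ \mathbb{P}\left\{\frac{R_{n,p}+1}{\sqrt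 n}\le t\right\}\longrightarrow\frac{2^{-\binom p2}}{\prod_{i=0}^{p-1}i!}\int_0^t\left(\left.\frac{\partial}{\partial z}T_p(z,w)\right|_{z=t}\right)dw,\qquad n\to\infty. \] -/

import Mathlib

open Filter Topology

/-- The set of `p`-watermelons of length `2 * n` (without wall). The value `W i k` is the ordinate
of the `i`-th path, `0 ≤ i < p`, at abscissa `k`, `0 ≤ k ≤ 2 * n`; thus the `i`-th path consists of
the lattice points `(k, W i k)`. -/
def watermelons (p n : ℕ) : Set (Fin p → Fin (2 * n + 1) → ℤ) :=
  {W | (∀ i, W i 0 = 2 * (i : ℤ)) ∧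
    (∀ i, W i (Fin.last (2 * n)) = 2 * (i : ℤ)) ∧
    (∀ i, ∀ k : Fin (2 * n),
      W i k.succ = W i k.castSucc + 1 ∨ W i k.succ = W i k.castSucc - 1) ∧
    (∀ k i j, i ≠ j → W i k ≠ W j k)}

/-- The height: the maximal ordinate reached by the topmost path. -/
def watermelonHeight {p n : ℕ} (hp : 0 < p) (W : Fin p → Fin (2 * n + 1) → ℤ) : ℤ :=
  Finset.univ.sup' Finset.univ_nonempty (W ⟨p - 1, Nat.sub_lt hp Nat.one_pos⟩)

/-- The minimal ordinate reached by the bottommost path. -/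
def watermelonBottom {p n : ℕ} (hp : 0 < p) (W : Fin p → Fin (2 * n + 1) → ℤ) : ℤ :=
  Finset.univ.inf' Finset.univ_nonempty (W ⟨0, hp⟩)

/-- The range: the maximum of the topmost path minus the minimum of the bottommost path. -/
def watermelonRange {p n : ℕ} (hp : 0 < p) (W : Fin p → Fin (2 * n + 1) → ℤ) : ℤ :=
  watermelonHeight hp W - watermelonBottom hp W

/-- The uniform probability measure on the set of `p`-watermelons of length `2 * n`. -/
noncomputable def watermelonMeasure (p n : ℕ) :
    MeasureTheory.Measure (Fin p → Fin (2 * n + 1) → ℤ) :=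
  ProbabilityTheory.uniformOn (watermelons p n)

/-- The (physicists') Hermite polynomials `H₀ = 1`, `H₁ = 2 X`, `H₂ = 4 X ^ 2 - 2`, ...,
orthogonal with respect to the weight `exp (-x ^ 2)`. (`Polynomial.hermite` is the family belonging
to the weight `exp (-x ^ 2 / 2)`.) -/
noncomputable def physHermite : ℕ → Polynomial ℝ
  | 0 => 1
  | k + 1 => 2 * Polynomial.X * physHermite k - Polynomial.derivative (physHermite k)

/-- The function `x ↦ H_a(x) exp (-x ^ 2)`. -/
noncomputable def hermiteGauss (a : ℕ) (x : ℝ) : ℝ :=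
  (physHermite a).eval x * Real.exp (-x ^ 2)

/-- The determinant `T_p(z, w)`. -/
noncomputable def rangeDet (p : ℕ) (z w : ℝ) : ℝ :=
  Matrix.det (Matrix.of fun i j : Fin p =>
    (-1 : ℝ) ^ (i : ℕ) * (∑' l : ℤ, hermiteGauss (i + j) (l * z))
      - ∑' l : ℤ, hermiteGauss (i + j) (l * z + w))

/-! Count, then take limits. By the reflection principle the number of `±1`-walks killed at two
walls is an alternating sum over periodic images, and the Karlin–McGregor argument turns the number
of watermelons strictly between the walls `-s` and `m - s` into a Toeplitz-minus-Hankel determinant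
of periodised bridge counts (`card_pathFamilies_eq_stripDet`). Raising the upper wall by one and
summing over `s` catches each watermelon of range less than `m` exactly once
(`card_watermelonRange_lt`).

Unimodular row and column differencing (`det_toeplitz_sub_hankel`) replaces the entries by forward
differences of order `a + b`. Scaled by `√n ^ (a + b)` and divided by the central count, these
converge to derivatives of `exp (-x ^ 2)` (`tendsto_scaledDiff`) and decay faster than any power,
uniformly in `n` (`exists_scaledDiff_decay`). Both facts rest on `bridgeCount_recurrence`, a
discrete form of the three-term recurrence of the Hermite polynomials.

Hence the lattice sums converge. The increment from `m` to `m + 1`, multiplied by `√n`, converges to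
the `z`-derivative of the limit determinant (`tendsto_sqrt_mul_entriesDet_sub`), and the sum over
`s` is a Riemann sum of mesh `1 / √n`, handled by dominated convergence
(`tendsto_sum_of_tendsto_floor`). The total number of watermelons carries the same scale factor; its
limit is a Hankel determinant of Hermite numbers, evaluated by a triangular factorisation
(`det_gaussDeriv_zero`). The quotient is the claim. -/

open scoped fwdDiff

/-! ### Walk and bridge counts -/

/-- The number of `±1`-walks with `N` steps and total displacement `k`. -/
def walkCount : ℕ → ℤ → ℝ
  | 0, k => if k = 0 then 1 else 0
  | N + 1, k => walkCount N (k + 1) + walkCount N (k - 1)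

lemma walkCount_neg (N : ℕ) (k : ℤ) : walkCount N (-k) = walkCount N k := by
  induction N generalizing k with
  | zero => simp [walkCount]
  | succ N ih =>
    rw [walkCount, walkCount, show -k + 1 = -(k - 1) by ring, show -k - 1 = -(k + 1) by ring,
      ih, ih, add_comm]

lemma walkCount_nonneg (N : ℕ) (k : ℤ) : 0 ≤ walkCount N k := by
  induction N generalizing k with
  | zero => simp only [walkCount]; split_ifs <;> norm_num
  | succ N ih => exact add_nonneg (ih _) (ih _)

lemma walkCount_eq_zero {N : ℕ} {k : ℤ} (h : (N : ℤ) < |k|) : walkCount N k = 0 := by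
  induction N generalizing k with
  | zero =>
    have : k ≠ 0 := by rintro rfl; simp at h
    simp [walkCount, this]
  | succ N ih =>
    push_cast at h
    rw [walkCount, ih, ih, add_zero]
    · rcases abs_cases k with hk | hk <;> rcases abs_cases (k - 1) with hj | hj <;> omega
    · rcases abs_cases k with hk | hk <;> rcases abs_cases (k + 1) with hj | hj <;> omega

/-- This is the ratio of consecutive binomial coefficients. Without division it also holds off the
support and for the wrong parity of `k`, so the Pascal step merely adds the identities at `k + 1`
and `k - 1`. -/
lemma walkCount_ratio (N : ℕ) (k : ℤ) :
    ((N : ℝ) + k + 2) * walkCount N (k + 2) = (N - k) * walkCount N k := by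
  induction N generalizing k with
  | zero =>
    simp only [walkCount]
    split_ifs with h1 h2 h2
    · omega
    · have : (k : ℝ) = -2 := by exact_mod_cast (by omega : k = -2)
      rw [this]; norm_num
    · simp [h2]
    · simp
  | succ N ih =>
    have h1 := ih (k + 1)
    have h2 := ih (k - 1)
    rw [show k + 1 + 2 = k + 2 + 1 by ring] at h1
    rw [show k - 1 + 2 = k + 1 by ring] at h2
    rw [walkCount, walkCount, show k + 2 - 1 = k + 1 by ring]
    push_cast at h1 h2 ⊢
    linear_combination h1 + h2

/-- The number of `±1`-walks with `2 * n` steps and total displacement `2 * k`. -/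
def bridgeCount (n : ℕ) (k : ℤ) : ℝ := walkCount (2 * n) (2 * k)

lemma bridgeCount_neg (n : ℕ) (k : ℤ) : bridgeCount n (-k) = bridgeCount n k := by
  rw [bridgeCount, mul_neg, walkCount_neg, bridgeCount]

lemma bridgeCount_nonneg (n : ℕ) (k : ℤ) : 0 ≤ bridgeCount n k := walkCount_nonneg _ _

lemma bridgeCount_eq_zero {n : ℕ} {k : ℤ} (h : (n : ℤ) < |k|) : bridgeCount n k = 0 := by
  apply walkCount_eq_zero
  rw [abs_mul, abs_two]
  push_cast
  omega

lemma bridgeCount_zero_pos (n : ℕ) : 0 < bridgeCount n 0 := by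
  induction n with
  | zero => simp [bridgeCount, walkCount]
  | succ n ih =>
    simp only [bridgeCount, Nat.mul_succ, walkCount, mul_zero] at ih ⊢
    norm_num
    have h1 := walkCount_nonneg (2 * n) 2
    have h2 := walkCount_nonneg (2 * n) (-2)
    linarith

lemma bridgeCount_ratio (n : ℕ) (k : ℤ) :
    ((n : ℝ) + k + 1) * bridgeCount n (k + 1) = (n - k) * bridgeCount n k := by
  have h := walkCount_ratio (2 * n) (2 * k)
  rw [bridgeCount, bridgeCount, mul_add, mul_one]
  push_cast at h
  linear_combination h / 2

lemma fwdDiff_iter_succ_apply (f : ℤ → ℝ) (a : ℕ) (k : ℤ) :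
    Δ_[1] ^[a + 1] f k = Δ_[1] ^[a] f (k + 1) - Δ_[1] ^[a] f k := by
  rw [Function.iterate_succ_apply', fwdDiff]

/-- The ratio identity says `(n + k + 1) Δf(k) = -(2k + 1) f(k)`. Applying the `a`-th difference
with the Leibniz rule for linear factors gives the claim. At `a = 0` the truncated `a - 1` is
harmless because its coefficient vanishes. -/
lemma bridgeCount_recurrence (n a : ℕ) (k : ℤ) :
    ((n : ℝ) + k + 1) * Δ_[1] ^[a + 1] (bridgeCount n) k + a * Δ_[1] ^[a] (bridgeCount n) (k + 1)
      = -(2 * k + 1) * Δ_[1] ^[a] (bridgeCount n) k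
        - 2 * a * Δ_[1] ^[a - 1] (bridgeCount n) (k + 1) := by
  induction a generalizing k with
  | zero =>
    have h := bridgeCount_ratio n k
    simp [fwdDiff]
    linear_combination h
  | succ a ih =>
    have h0 := ih k
    have h1 := ih (k + 1)
    have e1 := fwdDiff_iter_succ_apply (bridgeCount n) (a + 1) k
    have e2 := fwdDiff_iter_succ_apply (bridgeCount n) a k
    have e2' := fwdDiff_iter_succ_apply (bridgeCount n) a (k + 1)
    have e3 : (a : ℝ) * Δ_[1] ^[a] (bridgeCount n) (k + 1)
        = a * (Δ_[1] ^[a - 1] (bridgeCount n) (k + 1 + 1)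
          - Δ_[1] ^[a - 1] (bridgeCount n) (k + 1)) := by
      rcases a with _ | a
      · simp
      · rw [fwdDiff_iter_succ_apply, Nat.add_sub_cancel]
    rw [Nat.add_sub_cancel]
    push_cast at h1 ⊢
    linear_combination h1 - h0 + 2 * e3 + (n + k + 1) * e1 + a * e2' + (2 * k + 1) * e2

/-- Each ratio is `1 - (2k + 1) / (n + k + 1) ≤ exp (-(2k + 1) / (n + M))`, and the odd numbers add
up to a square. The lower bound `le_bridgeCount` treats the inverse ratios `1 + (2k + 1) / (n - k)`
in the same way. -/
lemma bridgeCount_le (n : ℕ) (k M : ℕ) (hk : k ≤ M) (hn : k ≤ n) :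
    bridgeCount n k ≤ bridgeCount n 0 * Real.exp (-(k : ℝ) ^ 2 / (n + M)) := by
  induction k with
  | zero => simp
  | succ k ih =>
    have h := bridgeCount_ratio n k
    have hkM : ((k : ℝ) + 1) ≤ M := by exact_mod_cast hk
    have hkn : ((k : ℝ) + 1) ≤ n := by exact_mod_cast hn
    have hk0 : (0 : ℝ) ≤ k := k.cast_nonneg
    have hp : (0 : ℝ) < n + k + 1 := by positivity
    have e : bridgeCount n (k + 1 : ℕ) = (n - k) / (n + k + 1) * bridgeCount n k := by
      rw [div_mul_eq_mul_div, eq_div_iff hp.ne']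
      push_cast at h ⊢
      linear_combination h
    have hr : ((n : ℝ) - k) / (n + k + 1) ≤ Real.exp (-((2 * k + 1) / (n + M))) := by
      refine le_trans ?_ (Real.one_sub_le_exp_neg _)
      have : (2 * (k : ℝ) + 1) / (n + M) ≤ (2 * k + 1) / (n + k + 1) := by
        apply div_le_div_of_nonneg_left <;> linarith
      have e2 : ((n : ℝ) - k) / (n + k + 1) = 1 - (2 * k + 1) / (n + k + 1) := by
        field_simp; ring
      linarith
    rw [e]
    calc _ ≤ Real.exp (-((2 * k + 1) / (n + M)))
          * (bridgeCount n 0 * Real.exp (-(k : ℝ) ^ 2 / (n + M))) := by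
          gcongr
          · exact bridgeCount_nonneg _ _
          · exact ih (by omega) (by omega)
      _ = _ := by
          rw [mul_left_comm, ← Real.exp_add]
          congr 2
          push_cast
          ring

lemma le_bridgeCount (n : ℕ) (k M : ℕ) (hk : k ≤ M) (hn : M ≤ n) :
    bridgeCount n 0 * Real.exp (-(k : ℝ) ^ 2 / (n - M + 1)) ≤ bridgeCount n k := by
  induction k with
  | zero => simp
  | succ k ih =>
    have h := bridgeCount_ratio n k
    have hkM : ((k : ℝ) + 1) ≤ M := by exact_mod_cast hk
    have hkn : (M : ℝ) ≤ n := by exact_mod_cast hn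
    have hk0 : (0 : ℝ) ≤ k := k.cast_nonneg
    have hp : (0 : ℝ) < n - k := by linarith
    have hp' : (0 : ℝ) < n - M + 1 := by linarith
    have e : bridgeCount n k = (n + k + 1) / (n - k) * bridgeCount n (k + 1 : ℕ) := by
      rw [div_mul_eq_mul_div, eq_div_iff hp.ne']
      push_cast at h ⊢
      linear_combination -h
    have hr : ((n : ℝ) + k + 1) / (n - k) ≤ Real.exp ((2 * k + 1) / (n - M + 1)) := by
      refine le_trans ?_ (Real.add_one_le_exp _)
      have : (2 * (k : ℝ) + 1) / (n - k) ≤ (2 * k + 1) / (n - M + 1) := by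
        apply div_le_div_of_nonneg_left <;> linarith
      have e2 : ((n : ℝ) + k + 1) / (n - k) = 1 + (2 * k + 1) / (n - k) := by
        field_simp; ring
      linarith
    have h1 := (ih (by omega)).trans (e.le.trans
      (mul_le_mul_of_nonneg_right hr (bridgeCount_nonneg n (k + 1 : ℕ))))
    have h2 := mul_le_mul_of_nonneg_left h1 (Real.exp_pos (-((2 * k + 1) / (n - M + 1)))).le
    rw [← mul_assoc, ← mul_assoc, ← Real.exp_add, neg_add_cancel, Real.exp_zero, one_mul,
      mul_right_comm, ← Real.exp_add, mul_comm] at h2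
    refine (le_of_eq ?_).trans h2
    congr 2
    push_cast
    ring

/-! ### Scaled differences and their uniform decay -/

/-- The iterated forward differences of the bridge counts in their natural scaling. -/
noncomputable def scaledDiff (n a : ℕ) (k : ℤ) : ℝ :=
  √(n : ℝ) ^ a * Δ_[1] ^[a] (bridgeCount n) k / bridgeCount n 0

lemma scaledDiff_succ (n a : ℕ) (k : ℤ) :
    scaledDiff n (a + 1) k = √(n : ℝ) * (scaledDiff n a (k + 1) - scaledDiff n a k) := by
  simp only [scaledDiff, fwdDiff_iter_succ_apply]
  ring

lemma scaledDiff_zero_neg (n : ℕ) (k : ℤ) : scaledDiff n 0 (-k) = scaledDiff n 0 k := by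
  simp [scaledDiff, bridgeCount_neg]

lemma scaledDiff_recurrence {n : ℕ} (hn : 0 < n) (a : ℕ) (k : ℤ) :
    ((n : ℝ) + k + 1) / n * scaledDiff n (a + 1) k
      = -(a / √(n : ℝ)) * scaledDiff n a (k + 1) - (2 * k + 1) / √(n : ℝ) * scaledDiff n a k
        - 2 * a * scaledDiff n (a - 1) (k + 1) := by
  have h := bridgeCount_recurrence n a k
  have hs : 0 < √(n : ℝ) := Real.sqrt_pos.2 (by exact_mod_cast hn)
  have hb := (bridgeCount_zero_pos n).ne'
  have e : (n : ℝ) = √(n : ℝ) ^ 2 := (Real.sq_sqrt n.cast_nonneg).symm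
  have hlast : (a : ℝ) * scaledDiff n (a - 1) (k + 1)
      = √(n : ℝ) ^ a / √(n : ℝ) * (a * Δ_[1] ^[a - 1] (bridgeCount n) (k + 1)) / bridgeCount n 0 := by
    rcases a with _ | a
    · simp
    · simp only [scaledDiff, Nat.add_sub_cancel]
      field_simp
      ring
  rw [mul_assoc 2 (a : ℝ), hlast]
  simp only [scaledDiff]
  generalize √(n : ℝ) = s at *
  rw [div_mul_eq_mul_div ((n : ℝ) + k + 1), e]
  rw [e] at h
  field_simp
  linear_combination s * s ^ a * h

lemma sqrt_natCast_one_le {n : ℕ} (hn : 0 < n) : 1 ≤ √(n : ℝ) :=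
  Real.one_le_sqrt.2 (by exact_mod_cast hn)

/-- For `2|k| ≤ n` the leading coefficient of `scaledDiff_recurrence` is at least `1 / 2`, so one
may divide by it. For larger `|k|` that coefficient may degenerate, but then `√n ≤ 2|k| / √n`, and
the trivial bound on a difference suffices. -/
lemma scaledDiff_succ_le {n : ℕ} (hn : 0 < n) (a : ℕ) (k : ℤ) :
    |scaledDiff n (a + 1) k| ≤ 4 * (a + 1) * ((1 + |(k : ℝ)| / √(n : ℝ)) *
      (|scaledDiff n a k| + |scaledDiff n a (k + 1)| + |scaledDiff n (a - 1) (k + 1)|)) := by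
  have hs := sqrt_natCast_one_le hn
  have hs0 : 0 < √(n : ℝ) := by linarith
  have hn0 : (0 : ℝ) < n := by exact_mod_cast hn
  have e : (n : ℝ) = √(n : ℝ) * √(n : ℝ) := (Real.mul_self_sqrt n.cast_nonneg).symm
  set s := √(n : ℝ)
  set x := |(k : ℝ)| / s with hx
  have hx0 : 0 ≤ x := by positivity
  have hkx : |(k : ℝ)| = x * s := by rw [hx]; field_simp
  set A := |scaledDiff n a k|
  set B := |scaledDiff n a (k + 1)|
  set C := |scaledDiff n (a - 1) (k + 1)|
  have hA : 0 ≤ A := abs_nonneg _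
  have hB : 0 ≤ B := abs_nonneg _
  have hC : 0 ≤ C := abs_nonneg _
  have ha : (0 : ℝ) ≤ a := a.cast_nonneg
  have hxA := mul_nonneg hx0 hA
  have hxB := mul_nonneg hx0 hB
  have hxC := mul_nonneg hx0 hC
  rcases le_or_gt (2 * |(k : ℝ)|) n with hk | hk
  · have h := scaledDiff_recurrence hn a k
    have h1 : 1 / 2 ≤ ((n : ℝ) + k + 1) / n := by
      rw [div_le_div_iff₀ two_pos hn0]
      have := neg_abs_le (k : ℝ)
      linarith
    have h2 : 1 / 2 * |scaledDiff n (a + 1) k| ≤ a * B + 2 * (1 + x) * A + 2 * a * C := by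
      calc _ ≤ ((n : ℝ) + k + 1) / n * |scaledDiff n (a + 1) k| := by gcongr
        _ = |((n : ℝ) + k + 1) / n * scaledDiff n (a + 1) k| := by
          rw [abs_mul, abs_of_nonneg (by linarith : (0 : ℝ) ≤ (n + k + 1) / n)]
        _ ≤ |-(a / s) * scaledDiff n a (k + 1)| + |(2 * k + 1) / s * scaledDiff n a k|
            + |2 * a * scaledDiff n (a - 1) (k + 1)| := by
          rw [h]
          exact (abs_sub _ _).trans (add_le_add (abs_sub _ _) le_rfl)
        _ ≤ _ := by
          rw [abs_mul, abs_mul, abs_mul, abs_neg, abs_of_nonneg (by positivity : 0 ≤ a / s),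
            abs_of_nonneg (by positivity : (0 : ℝ) ≤ 2 * a)]
          gcongr
          · exact div_le_self ha hs
          · rw [abs_div, abs_of_pos hs0, div_le_iff₀ hs0]
            have := abs_add_le (2 * (k : ℝ)) 1
            rw [abs_mul, abs_two, abs_one, hkx] at this
            nlinarith
    have hax := mul_nonneg ha hx0
    nlinarith [mul_nonneg ha hA, mul_nonneg ha hB, mul_nonneg ha hC, mul_nonneg hax hA,
      mul_nonneg hax hB, mul_nonneg hax hC]
  · have h1 : s ≤ 2 * x := by
      rw [hkx, e] at hk
      by_contra! hcon
      nlinarith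
    have h2 : |scaledDiff n (a + 1) k| ≤ 2 * x * (A + B) := by
      rw [scaledDiff_succ, abs_mul, abs_of_pos hs0]
      refine mul_le_mul h1 ?_ (abs_nonneg _) (by linarith)
      have := abs_sub (scaledDiff n a (k + 1)) (scaledDiff n a k)
      linarith
    have hax := mul_nonneg ha hx0
    nlinarith [mul_nonneg ha hA, mul_nonneg ha hB, mul_nonneg ha hC, mul_nonneg hax hA,
      mul_nonneg hax hB, mul_nonneg hax hC]

lemma exists_pow_mul_exp_neg_sq_le (q : ℕ) :
    ∃ C : ℝ, ∀ x : ℝ, 0 ≤ x → (1 + x) ^ q * Real.exp (-x ^ 2 / 2) ≤ C := by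
  -- `(1 + x) ^ q ≤ q! exp (1 + x)`, and `1 + x - x ^ 2 / 2` is at most `3 / 2`, its value at `x =
  -- 1`.
  refine ⟨q.factorial * Real.exp (3 / 2), fun x hx => ?_⟩
  have h1 := Real.pow_div_factorial_le_exp (1 + x) (by linarith) q
  rw [div_le_iff₀ (by positivity)] at h1
  calc _ ≤ (Real.exp (1 + x) * q.factorial) * Real.exp (-x ^ 2 / 2) := by gcongr
    _ = q.factorial * Real.exp (1 + x + -x ^ 2 / 2) := by rw [Real.exp_add (1 + x)]; ring
    _ ≤ _ := by
      gcongr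
      nlinarith [sq_nonneg (x - 1)]

lemma scaledDiff_zero_le {n : ℕ} (hn : 0 < n) (k : ℤ) :
    |scaledDiff n 0 k| ≤ Real.exp (-(|(k : ℝ)| / √(n : ℝ)) ^ 2 / 2) := by
  have hb := bridgeCount_zero_pos n
  have hn0 : (0 : ℝ) < n := by exact_mod_cast hn
  rw [abs_of_nonneg (by
    have := bridgeCount_nonneg n k
    simp only [scaledDiff, pow_zero, one_mul, Function.iterate_zero, id]
    positivity)]
  have key : scaledDiff n 0 k = scaledDiff n 0 (k.natAbs : ℕ) := by
    rcases Int.natAbs_eq k with h | h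
    · rw [← h]
    · conv_lhs => rw [h]
      exact scaledDiff_zero_neg n _
  have hk : |(k : ℝ)| = (k.natAbs : ℝ) := by
    rw [Nat.cast_natAbs, Int.cast_abs]
  rw [key, hk]
  generalize k.natAbs = m
  simp only [scaledDiff, pow_zero, one_mul, Function.iterate_zero, id]
  rw [div_le_iff₀ hb, mul_comm, div_pow, Real.sq_sqrt hn0.le]
  -- `bridgeCount_le` with `M = n` gives the exponent `-m ^ 2 / (2n)`; beyond `n` the count
  -- vanishes.
  rcases le_or_gt m n with hm | hm
  · refine (bridgeCount_le n m n hm hm).trans_eq ?_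
    congr 2
    field_simp
    ring
  · rw [bridgeCount_eq_zero (by simpa using hm)]
    positivity

lemma one_add_abs_div_sqrt_le {n : ℕ} (hn : 0 < n) (k : ℤ) :
    1 + |(k : ℝ)| / √(n : ℝ) ≤ 2 * (1 + |((k + 1 : ℤ) : ℝ)| / √(n : ℝ)) := by
  have hs := sqrt_natCast_one_le hn
  have hs0 : 0 < √(n : ℝ) := by linarith
  have h1 : |(k : ℝ)| ≤ |((k + 1 : ℤ) : ℝ)| + 1 := by
    have := abs_sub ((k : ℝ) + 1) 1
    push_cast
    simpa using this
  have h2 : |(k : ℝ)| / √(n : ℝ) ≤ |((k + 1 : ℤ) : ℝ)| / √(n : ℝ) + 1 := by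
    rw [div_add' _ _ _ hs0.ne']
    gcongr
    linarith
  have : 0 ≤ |((k + 1 : ℤ) : ℝ)| / √(n : ℝ) := by positivity
  linarith

/-- The scaled differences decay faster than any power, uniformly in `n`. -/
lemma exists_scaledDiff_decay (a q : ℕ) : ∃ C : ℝ, ∀ n : ℕ, 0 < n → ∀ k : ℤ,
    (1 + |(k : ℝ)| / √(n : ℝ)) ^ q * |scaledDiff n a k| ≤ C := by
  induction a using Nat.strong_induction_on generalizing q with
  | _ a ih =>
    rcases a with _ | a
    · obtain ⟨C, hC⟩ := exists_pow_mul_exp_neg_sq_le q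
      refine ⟨C, fun n hn k => le_trans ?_ (hC (|(k : ℝ)| / √(n : ℝ)) (by positivity))⟩
      gcongr
      exact scaledDiff_zero_le hn k
    · obtain ⟨C₁, h₁⟩ := ih a (by omega) (q + 1)
      obtain ⟨C₂, h₂⟩ := ih (a - 1) (by omega) (q + 1)
      -- Each order of differencing costs one power of the weight, hence the induction hypotheses at
      -- `q + 1`. The shift `k ↦ k + 1` at most doubles the weight, hence `2 ^ (q + 1)`.
      refine ⟨4 * (a + 1) * (C₁ + 2 ^ (q + 1) * C₁ + 2 ^ (q + 1) * C₂), fun n hn k => ?_⟩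
      have hshift : ∀ {b : ℕ} {C : ℝ}, (∀ n : ℕ, 0 < n → ∀ k : ℤ,
          (1 + |(k : ℝ)| / √(n : ℝ)) ^ (q + 1) * |scaledDiff n b k| ≤ C) →
          (1 + |(k : ℝ)| / √(n : ℝ)) ^ (q + 1) * |scaledDiff n b (k + 1)| ≤ 2 ^ (q + 1) * C := by
        intro b C h
        have := h n hn (k + 1)
        calc _ ≤ (2 * (1 + |((k + 1 : ℤ) : ℝ)| / √(n : ℝ))) ^ (q + 1)
              * |scaledDiff n b (k + 1)| := by
              gcongr
              exact one_add_abs_div_sqrt_le hn k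
          _ ≤ _ := by
              rw [mul_pow, mul_assoc]
              gcongr
      have e1 := h₁ n hn k
      have e2 := hshift h₁
      have e3 := hshift h₂
      calc _ ≤ (1 + |(k : ℝ)| / √(n : ℝ)) ^ q *
            (4 * (a + 1) * ((1 + |(k : ℝ)| / √(n : ℝ)) * (|scaledDiff n a k|
              + |scaledDiff n a (k + 1)| + |scaledDiff n (a - 1) (k + 1)|))) := by
            gcongr
            exact scaledDiff_succ_le hn a k
        _ = 4 * (a + 1) * ((1 + |(k : ℝ)| / √(n : ℝ)) ^ (q + 1) * |scaledDiff n a k|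
            + (1 + |(k : ℝ)| / √(n : ℝ)) ^ (q + 1) * |scaledDiff n a (k + 1)|
            + (1 + |(k : ℝ)| / √(n : ℝ)) ^ (q + 1) * |scaledDiff n (a - 1) (k + 1)|) := by
            ring
        _ ≤ _ := by gcongr

/-! ### Hermite functions and the local limit theorem -/

lemma derivative_physHermite_succ (k : ℕ) :
    Polynomial.derivative (physHermite (k + 1)) = 2 * ((k : Polynomial ℝ) + 1) * physHermite k := by
  induction k with
  | zero => simp [physHermite]
  | succ k ih =>
    have h : physHermite (k + 1) = 2 * Polynomial.X * physHermite k
      - Polynomial.derivative (physHermite k) := rfl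
    rw [show physHermite (k + 1 + 1) = 2 * Polynomial.X * physHermite (k + 1)
      - Polynomial.derivative (physHermite (k + 1)) from rfl, ih]
    simp only [Polynomial.derivative_sub, Polynomial.derivative_mul, Polynomial.derivative_X, ih,
      Polynomial.derivative_add, Polynomial.derivative_natCast, Polynomial.derivative_one,
      Polynomial.derivative_ofNat]
    push_cast
    linear_combination 2 * ((k : Polynomial ℝ) + 1) * (-h)

lemma hermiteGauss_recurrence (a : ℕ) (x : ℝ) :
    hermiteGauss (a + 1) x = 2 * x * hermiteGauss a x - 2 * a * hermiteGauss (a - 1) x := by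
  rcases a with _ | a
  · simp [hermiteGauss, physHermite]
  · rw [hermiteGauss, physHermite, derivative_physHermite_succ]
    simp [hermiteGauss]
    ring

lemma hermiteGauss_hasDerivAt (a : ℕ) (x : ℝ) :
    HasDerivAt (hermiteGauss a) (-hermiteGauss (a + 1) x) x := by
  have h := ((physHermite a).hasDerivAt x).mul (((hasDerivAt_id x).pow 2).neg.exp)
  refine h.congr_deriv ?_
  simp [hermiteGauss, physHermite]
  ring

/-- Normalising by the central count avoids Stirling's formula. With `m = |k n|` and `M = m`, the
two bounds have exponents `-m ^ 2 / (n + m)` and `-m ^ 2 / (n - m + 1)`; both tend to `-x ^ 2` since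
`m / n` tends to `0`. -/
lemma tendsto_scaledDiff_zero {k : ℕ → ℤ} {x : ℝ}
    (hk : Tendsto (fun n : ℕ => (k n : ℝ) / √(n : ℝ)) atTop (𝓝 x)) :
    Tendsto (fun n => scaledDiff n 0 (k n)) atTop (𝓝 (Real.exp (-x ^ 2))) := by
  have hs : Tendsto (fun n : ℕ => √(n : ℝ)) atTop atTop :=
    Real.tendsto_sqrt_atTop.comp tendsto_natCast_atTop_atTop
  have hinv : Tendsto (fun n : ℕ => (√(n : ℝ))⁻¹) atTop (𝓝 0) := hs.inv_tendsto_atTop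
  set m : ℕ → ℕ := fun n => (k n).natAbs with hm
  have hmx : Tendsto (fun n : ℕ => (m n : ℝ) / √(n : ℝ)) atTop (𝓝 |x|) := by
    refine hk.abs.congr fun n => ?_
    rw [abs_div, abs_of_nonneg (Real.sqrt_nonneg _), hm, Nat.cast_natAbs, Int.cast_abs]
  have hmn : Tendsto (fun n : ℕ => (m n : ℝ) / n) atTop (𝓝 0) := by
    have := hmx.mul hinv
    rw [mul_zero] at this
    refine this.congr fun n => ?_
    rw [← div_eq_mul_inv, div_div, Real.mul_self_sqrt n.cast_nonneg]
  have hm2 : Tendsto (fun n : ℕ => (m n : ℝ) ^ 2 / n) atTop (𝓝 (x ^ 2)) := by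
    have := hmx.pow 2
    rw [sq_abs] at this
    refine this.congr fun n => ?_
    rw [div_pow, Real.sq_sqrt n.cast_nonneg]
  have hn1 : Tendsto (fun n : ℕ => 1 / (n : ℝ)) atTop (𝓝 0) := tendsto_one_div_atTop_nhds_zero_nat
  have hle : ∀ᶠ n : ℕ in atTop, 0 < n ∧ m n ≤ n := by
    filter_upwards [hmn.eventually (gt_mem_nhds one_pos), eventually_gt_atTop 0] with n h h0
    have hn0 : (0 : ℝ) < n := by exact_mod_cast h0
    rw [div_lt_one hn0] at h
    exact ⟨h0, by exact_mod_cast h.le⟩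
  have key : ∀ n, scaledDiff n 0 (k n) = bridgeCount n (m n) / bridgeCount n 0 := by
    intro n
    have e : scaledDiff n 0 (k n) = scaledDiff n 0 (m n : ℕ) := by
      rcases Int.natAbs_eq (k n) with h | h
      · rw [← h]
      · conv_lhs => rw [h]
        exact scaledDiff_zero_neg n _
    rw [e]
    simp [scaledDiff]
  have hup : Tendsto (fun n : ℕ => Real.exp (-((m n : ℝ) ^ 2 / n) / (1 + (m n : ℝ) / n))) atTop
      (𝓝 (Real.exp (-x ^ 2))) := by
    refine (Real.continuous_exp.tendsto _).comp ?_
    have := hm2.neg.div (hmn.const_add 1) (by norm_num)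
    simpa [Pi.div_def] using this
  have hlo : Tendsto (fun n : ℕ => Real.exp (-((m n : ℝ) ^ 2 / n) / (1 - (m n : ℝ) / n + 1 / n)))
      atTop (𝓝 (Real.exp (-x ^ 2))) := by
    refine (Real.continuous_exp.tendsto _).comp ?_
    have := hm2.neg.div ((hmn.const_sub 1).add hn1) (by norm_num)
    simpa [Pi.div_def] using this
  refine tendsto_of_tendsto_of_tendsto_of_le_of_le' hlo hup ?_ ?_
  · filter_upwards [hle] with n hn
    have hn0 : (0 : ℝ) < n := by exact_mod_cast hn.1
    have hmn' : (m n : ℝ) ≤ n := by exact_mod_cast hn.2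
    rw [key, le_div_iff₀ (bridgeCount_zero_pos n), mul_comm]
    refine (le_of_eq ?_).trans (le_bridgeCount n (m n) (m n) le_rfl hn.2)
    have : (0 : ℝ) < n - m n + 1 := by linarith
    congr 2
    field_simp
  · filter_upwards [hle] with n hn
    have hn0 : (0 : ℝ) < n := by exact_mod_cast hn.1
    rw [key, div_le_iff₀ (bridgeCount_zero_pos n), mul_comm]
    refine (bridgeCount_le n (m n) (m n) le_rfl hn.2).trans_eq ?_
    congr 2
    field_simp

lemma tendsto_intCast_add_div_sqrt {k : ℕ → ℤ} {x : ℝ} (c : ℤ)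
    (hk : Tendsto (fun n : ℕ => (k n : ℝ) / √(n : ℝ)) atTop (𝓝 x)) :
    Tendsto (fun n : ℕ => ((k n + c : ℤ) : ℝ) / √(n : ℝ)) atTop (𝓝 x) := by
  have hs : Tendsto (fun n : ℕ => (√(n : ℝ))⁻¹) atTop (𝓝 0) :=
    (Real.tendsto_sqrt_atTop.comp tendsto_natCast_atTop_atTop).inv_tendsto_atTop
  have := hk.add (hs.const_mul (c : ℝ))
  rw [mul_zero, add_zero] at this
  refine this.congr fun n => ?_
  push_cast
  ring

/-- The local limit theorem for the scaled differences of the bridge counts. -/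
lemma tendsto_scaledDiff (a : ℕ) {k : ℕ → ℤ} {x : ℝ}
    (hk : Tendsto (fun n : ℕ => (k n : ℝ) / √(n : ℝ)) atTop (𝓝 x)) :
    Tendsto (fun n => scaledDiff n a (k n)) atTop (𝓝 ((-1) ^ a * hermiteGauss a x)) := by
  induction a using Nat.strong_induction_on generalizing k with
  | _ a ih =>
    rcases a with _ | a
    · simpa [hermiteGauss, physHermite] using tendsto_scaledDiff_zero hk
    · have hs : Tendsto (fun n : ℕ => (√(n : ℝ))⁻¹) atTop (𝓝 0) :=
        (Real.tendsto_sqrt_atTop.comp tendsto_natCast_atTop_atTop).inv_tendsto_atTop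
      have hk1 := tendsto_intCast_add_div_sqrt 1 hk
      have h0 := ih a (by omega) hk
      have h1 := ih a (by omega) hk1
      have hden : Tendsto (fun n : ℕ => ((n : ℝ) + k n + 1) / n) atTop (𝓝 1) := by
        have := (hk1.mul hs).const_add 1
        rw [mul_zero, add_zero] at this
        refine this.congr' ?_
        filter_upwards [eventually_gt_atTop 0] with n hn
        have hn0 : (0 : ℝ) < n := by exact_mod_cast hn
        rw [← div_eq_mul_inv, div_div, Real.mul_self_sqrt n.cast_nonneg]
        push_cast
        field_simp
        ring
      have hlast : Tendsto (fun n => (a : ℝ) * scaledDiff n (a - 1) (k n + 1)) atTop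
          (𝓝 (a * ((-1) ^ (a - 1) * hermiteGauss (a - 1) x))) :=
        (ih (a - 1) (by omega) hk1).const_mul _
      -- Solved for order `a + 1`, the discrete recurrence passes in the limit to
      -- `hermiteGauss_recurrence`, up to the sign `(-1) ^ (a + 1)`.
      have hnum := ((((hs.const_mul (a : ℝ)).neg.mul h1).sub
        (((hk.const_mul 2).add hs).mul h0)).sub (hlast.const_mul 2)).div hden one_ne_zero
      convert hnum.congr' ?_ using 2
      · rw [hermiteGauss_recurrence]
        rcases a with _ | a
        · simp
        · simp only [Nat.add_sub_cancel]
          push_cast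
          ring
      · filter_upwards [eventually_gt_atTop 0,
          hden.eventually (lt_mem_nhds one_pos)] with n hn hd
        rw [Pi.div_apply, div_eq_iff hd.ne', mul_comm (scaledDiff n (a + 1) (k n)), scaledDiff_recurrence hn]
        ring

/-! ### Nonintersecting paths between two walls -/

/-- The families of `p` pairwise disjoint `±1`-paths with `N` steps from `x` to `y` that stay
strictly between `α` and `β`, indexed by time first. -/
noncomputable def pathFamilies {p : ℕ} (N : ℕ) (α β : ℤ) (x y : Fin p → ℤ) :
    Finset (Fin (N + 1) → Fin p → ℤ) :=
  open scoped Classical in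
  {W ∈ Fintype.piFinset fun _ => Fintype.piFinset fun _ => Finset.Ioo α β |
    W 0 = x ∧ W (Fin.last N) = y ∧
    (∀ k : Fin N, ∀ i, W k.succ i = W k.castSucc i + 1 ∨ W k.succ i = W k.castSucc i - 1) ∧
    ∀ k, Function.Injective (W k)}

lemma mem_pathFamilies {p N : ℕ} {α β : ℤ} {x y : Fin p → ℤ} {W : Fin (N + 1) → Fin p → ℤ} :
    W ∈ pathFamilies N α β x y ↔ (∀ k i, α < W k i ∧ W k i < β) ∧
      W 0 = x ∧ W (Fin.last N) = y ∧
      (∀ k : Fin N, ∀ i, W k.succ i = W k.castSucc i + 1 ∨ W k.succ i = W k.castSucc i - 1) ∧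
      ∀ k, Function.Injective (W k) := by
  simp [pathFamilies]

lemma pathFamilies_eq_empty {p N : ℕ} {α β : ℤ} {x y : Fin p → ℤ}
    (h : ¬ ((∀ i, α < x i ∧ x i < β) ∧ Function.Injective x)) : pathFamilies N α β x y = ∅ := by
  rw [Finset.eq_empty_iff_forall_notMem]
  intro W hW
  rw [mem_pathFamilies] at hW
  obtain ⟨h1, rfl, -, -, h2⟩ := hW
  exact h ⟨h1 0, h2 0⟩

/-- Removing the initial time is a bijection once the signs of the first steps are fixed. Indexing
by sign vectors matches the row-multilinear expansion of the determinant. -/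
lemma card_pathFamilies_succ {p : ℕ} (N : ℕ) {α β : ℤ} {x y : Fin p → ℤ}
    (hx : ∀ i, α < x i ∧ x i < β) (hinj : Function.Injective x) :
    (pathFamilies (N + 1) α β x y).card
      = ∑ r : Fin p → Bool,
          (pathFamilies N α β (fun i => x i + if r i then 1 else -1) y).card := by
  rw [Finset.card_eq_sum_card_fiberwise (f := fun W i => decide (W (Fin.succ 0) i = x i + 1))
    (t := Finset.univ) (fun _ _ => by simp)]
  refine Finset.sum_congr rfl fun r _ => ?_
  refine Finset.card_nbij' (fun W k => W k.succ) (fun V => Fin.cons x V) ?_ ?_ ?_ ?_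
  · intro W hW
    simp only [Finset.coe_filter, Set.mem_ofPred_eq, Finset.mem_coe, mem_pathFamilies] at hW ⊢
    obtain ⟨⟨h1, h2, h3, h4, h5⟩, h6⟩ := hW
    refine ⟨fun k i => h1 _ i, ?_, h3, fun k i => ?_, fun k => h5 _⟩
    · funext i
      have h7 := congrFun h6 i
      have h8 := h4 0 i
      rw [Fin.castSucc_zero, h2] at h8
      rw [← h7]
      by_cases hc : W (Fin.succ 0) i = x i + 1
      · simp only [hc, decide_true, if_true]
      · simp only [hc, decide_false, Bool.false_eq_true, if_false]
        rcases h8 with h8 | h8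
        · exact absurd h8 hc
        · rw [h8]; ring
    · have := h4 k.succ i
      rwa [← Fin.succ_castSucc] at this
  · intro V hV
    simp only [Finset.coe_filter, Set.mem_ofPred_eq, Finset.mem_coe, mem_pathFamilies] at hV ⊢
    obtain ⟨h1, h2, h3, h4, h5⟩ := hV
    refine ⟨⟨fun k i => ?_, by simp, ?_, fun k i => ?_, fun k => ?_⟩, ?_⟩
    · cases k using Fin.cases with
      | zero => simpa using hx i
      | succ k => simpa using h1 k i
    · rw [← Fin.succ_last, Fin.cons_succ, h3]
    · cases k using Fin.cases with
      | zero =>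
        rw [Fin.cons_succ, h2, Fin.castSucc_zero, Fin.cons_zero]
        rcases hr : r i
        · right; simp [hr, sub_eq_add_neg]
        · left; simp [hr]
      | succ k =>
        rw [Fin.cons_succ, ← Fin.succ_castSucc, Fin.cons_succ]
        exact h4 k i
    · cases k using Fin.cases with
      | zero => simpa using hinj
      | succ k => simpa using h5 k
    · funext i
      rw [Fin.cons_succ, h2]
      rcases hr : r i <;> simp [hr]
  · intro W hW
    simp only [Finset.coe_filter, Set.mem_ofPred_eq, mem_pathFamilies] at hW
    obtain ⟨⟨-, h2, -⟩, -⟩ := hW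
    funext k
    cases k using Fin.cases with
    | zero => simp [h2]
    | succ k => simp
  · intro V hV
    funext k
    simp

/-- Equal parity makes all gaps at least `2`, and one step shrinks a gap by at most `2`. Thus paths
cannot cross without meeting. -/
lemma strictMono_add_step {p : ℕ} {x x' : Fin p → ℤ} (hx : StrictMono x)
    (hpar : ∀ i j, x i ≡ x j [ZMOD 2]) (hstep : ∀ i, x' i = x i + 1 ∨ x' i = x i - 1)
    (hinj : Function.Injective x') : StrictMono x' := by
  intro i j hij
  have h1 := hx hij
  have h2 := hpar i j
  have h3 : x' i ≠ x' j := fun h => hij.ne (hinj h)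
  rw [Int.ModEq] at h2
  have h4 := hstep i
  have h5 := hstep j
  omega

lemma modEq_add_step {p : ℕ} {x x' : Fin p → ℤ}
    (hpar : ∀ i j, x i ≡ x j [ZMOD 2]) (hstep : ∀ i, x' i = x i + 1 ∨ x' i = x i - 1)
    (i j : Fin p) : x' i ≡ x' j [ZMOD 2] := by
  have h2 := hpar i j
  rw [Int.ModEq] at h2 ⊢
  have h4 := hstep i
  have h5 := hstep j
  omega

/-- The Karlin–McGregor (Lindström–Gessel–Viennot) determinant for `±1`-paths between two
absorbing walls. -/
theorem card_pathFamilies_eq_det {p : ℕ} {α β : ℤ} (u : ℕ → ℤ → ℤ → ℝ)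
    (hu : ∀ N x z, u (N + 1) x z = u N (x + 1) z + u N (x - 1) z)
    (hα : ∀ N z, u N α z = 0) (hβ : ∀ N z, u N β z = 0)
    (h0 : ∀ x z, α < x → x < β → α < z → z < β → u 0 x z = if x = z then 1 else 0)
    {y : Fin p → ℤ} (hy : StrictMono y) (hyI : ∀ i, α < y i ∧ y i < β) (N : ℕ)
    {x : Fin p → ℤ} (hx : StrictMono x) (hxI : ∀ i, α < x i ∧ x i < β)
    (hpar : ∀ i j, x i ≡ x j [ZMOD 2]) :
    ((pathFamilies N α β x y).card : ℝ) = Matrix.det (Matrix.of fun i j => u N (x i) (y j)) := by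
  induction N generalizing x with
  | zero =>
    have hent : (Matrix.of fun i j => u 0 (x i) (y j))
        = Matrix.of fun i j => if x i = y j then (1 : ℝ) else 0 := by
      ext i j
      exact h0 _ _ (hxI i).1 (hxI i).2 (hyI j).1 (hyI j).2
    rw [hent]
    by_cases hxy : x = y
    · subst hxy
      have h1 : pathFamilies 0 α β x x = {fun _ => x} := by
        ext W
        rw [mem_pathFamilies, Finset.mem_singleton]
        constructor
        · rintro ⟨-, h, -⟩
          funext k
          rw [show k = 0 from Fin.ext (by omega), h]
        · rintro rfl
          exact ⟨fun _ => hxI, rfl, rfl, fun k => k.elim0, fun _ => hx.injective⟩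
      have h2 : (Matrix.of fun i j => if x i = x j then (1 : ℝ) else 0) = 1 := by
        ext i j
        simp [Matrix.one_apply, hx.injective.eq_iff]
      rw [h1, h2]
      simp
    · have h1 : pathFamilies 0 α β x y = ∅ := by
        rw [Finset.eq_empty_iff_forall_notMem]
        intro W hW
        rw [mem_pathFamilies] at hW
        exact hxy (hW.2.1.symm.trans hW.2.2.1)
      -- Two strictly increasing families of the same size with the same range coincide. So some
      -- starting point is not an end point, and its row is zero.
      obtain ⟨i, hi⟩ : ∃ i, ∀ j, x i ≠ y j := by
        by_contra! hcon
        refine hxy ((StrictMono.range_inj hx hy).1 ?_)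
        have hsub : Finset.univ.image x ⊆ Finset.univ.image y := by
          intro a ha
          obtain ⟨i, -, rfl⟩ := Finset.mem_image.1 ha
          obtain ⟨j, hj⟩ := hcon i
          exact Finset.mem_image.2 ⟨j, Finset.mem_univ _, hj.symm⟩
        have heq := Finset.eq_of_subset_of_card_le hsub (by
          rw [Finset.card_image_of_injective _ hx.injective,
            Finset.card_image_of_injective _ hy.injective])
        have := congrArg (fun s : Finset ℤ => (s : Set ℤ)) heq
        simpa using this
      rw [h1, Matrix.det_eq_zero_of_row_eq_zero i]
      · simp
      · intro j
        simp [hi j]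
  | succ N ih =>
    rw [card_pathFamilies_succ N hxI hx.injective]
    have hdet : Matrix.det (Matrix.of fun i j => u (N + 1) (x i) (y j))
        = ∑ r : Fin p → Bool,
          Matrix.det (Matrix.of fun i j => u N (x i + if r i then 1 else -1) (y j)) := by
      -- Every row is a sum of two rows, one for each direction of the step; multilinearity yields
      -- one determinant for each sign vector.
      have h := (Matrix.detRowAlternating (n := Fin p) (R := ℝ)).toMultilinearMap.map_sum
        (fun (i : Fin p) (b : Bool) (j : Fin p) => u N (x i + if b then 1 else -1) (y j))
      refine Eq.trans ?_ h
      refine congrArg Matrix.det ?_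
      ext i j
      simp [hu, sub_eq_add_neg]
    rw [hdet]
    push_cast
    refine Finset.sum_congr rfl fun r _ => ?_
    have hstep : ∀ i, x i + (if r i then 1 else -1) = x i + 1
        ∨ x i + (if r i then 1 else -1) = x i - 1 := by
      intro i
      rcases r i <;> simp [sub_eq_add_neg]
    generalize hx' : (fun i => x i + if r i then (1 : ℤ) else -1) = x' at *
    have hxx : ∀ i, x i + (if r i then 1 else -1) = x' i := fun i => congrFun hx' i
    simp only [hxx] at hstep ⊢
    -- The inadmissible sign vectors contribute zero on both sides: a collision gives two equal
    -- rows, and a point leaving the strip lands exactly on a wall, giving a zero row. No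
    -- sign-reversing involution is needed.
    by_cases hinj : Function.Injective x'
    · by_cases hI : ∀ i, α < x' i ∧ x' i < β
      · exact ih (strictMono_add_step hx hpar hstep hinj) hI (modEq_add_step hpar hstep)
      · rw [pathFamilies_eq_empty (fun h => hI h.1)]
        push Not at hI
        obtain ⟨i, hi⟩ := hI
        have hi' : x' i = α ∨ x' i = β := by
          have h1 := hstep i
          have h2 := hxI i
          by_cases hc : α < x' i
          · have := hi hc
            omega
          · omega
        rw [Matrix.det_eq_zero_of_row_eq_zero i]
        · simp
        · intro j
          rcases hi' with hi' | hi' <;> simp [hi', hα, hβ]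
    · rw [pathFamilies_eq_empty (fun h => hinj h.2)]
      simp only [Function.Injective] at hinj
      push Not at hinj
      obtain ⟨i, j, hij, hne⟩ := hinj
      rw [Matrix.det_zero_of_row_eq hne]
      · simp
      · funext k
        simp [hij]

/-! ### Periodic images and the strip determinant -/

lemma finite_abs_add_mul_le {m : ℤ} (hm : 0 < m) (k N : ℤ) : {l : ℤ | |k + l * m| ≤ N}.Finite := by
  refine (Set.finite_Icc (-(N + |k|)) (N + |k|)).subset fun l hl => ?_
  have h1 : |l * m| ≤ N + |k| := by
    have := abs_sub (k + l * m) k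
    rw [add_sub_cancel_left] at this
    exact this.trans (add_le_add_left hl _)
  rw [abs_mul, abs_of_pos hm] at h1
  have h2 : |l| ≤ |l| * m := le_mul_of_one_le_right (abs_nonneg _) hm
  exact abs_le.1 (h2.trans h1)

lemma summable_walkCount {m : ℤ} (hm : 0 < m) (N : ℕ) (k : ℤ) :
    Summable fun l : ℤ => walkCount N (k + l * m) := by
  refine summable_of_hasFiniteSupport ((finite_abs_add_mul_le hm k N).subset fun l hl => ?_)
  by_contra hcon
  exact hl (walkCount_eq_zero (not_le.1 hcon))

/-- The walk counts made periodic with period `m`. -/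
noncomputable def periodicWalk (m : ℤ) (N : ℕ) (k : ℤ) : ℝ := ∑' l : ℤ, walkCount N (k + l * m)

lemma periodicWalk_succ {m : ℤ} (hm : 0 < m) (N : ℕ) (k : ℤ) :
    periodicWalk m (N + 1) k = periodicWalk m N (k + 1) + periodicWalk m N (k - 1) := by
  rw [periodicWalk, periodicWalk, periodicWalk,
    ← (summable_walkCount hm N _).tsum_add (summable_walkCount hm N _)]
  refine tsum_congr fun l => ?_
  rw [walkCount]
  congr 2 <;> ring

lemma periodicWalk_add_period (m : ℤ) (N : ℕ) (k : ℤ) :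
    periodicWalk m N (k + m) = periodicWalk m N k := by
  rw [periodicWalk, periodicWalk,
    ← (Equiv.addRight (1 : ℤ)).tsum_eq (fun l => walkCount N (k + l * m))]
  refine tsum_congr fun l => ?_
  congr 1
  simp
  ring

lemma periodicWalk_zero {m k : ℤ} (hk : |k| < m) :
    periodicWalk m 0 k = if k = 0 then 1 else 0 := by
  rw [periodicWalk, tsum_eq_single 0]
  · simp [walkCount]
  · intro l hl
    refine walkCount_eq_zero ?_
    have h1 : m ≤ |l * m| := by
      rw [abs_mul, abs_of_pos ((abs_nonneg k).trans_lt hk)]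
      have : 1 ≤ |l| := Int.one_le_abs hl
      have := abs_nonneg k
      nlinarith
    have := abs_sub (k + l * m) k
    rw [add_sub_cancel_left] at this
    push_cast
    linarith

/-- The number of `±1`-walks with `2 * n` steps whose displacement is `2 * k` modulo `2 * m`. -/
noncomputable def periodicBridge (n : ℕ) (m k : ℤ) : ℝ := ∑' l : ℤ, bridgeCount n (l * m + k)

lemma periodicBridge_eq (n : ℕ) (m k : ℤ) :
    periodicBridge n m k = periodicWalk (2 * m) (2 * n) (2 * k) := by
  refine tsum_congr fun l => ?_
  rw [bridgeCount]
  congr 1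
  ring

lemma periodicBridge_add_period (n : ℕ) (m k : ℤ) :
    periodicBridge n m (k + m) = periodicBridge n m k := by
  rw [periodicBridge_eq, mul_add, periodicWalk_add_period, periodicBridge_eq]

/-- The determinant counting the watermelons strictly between the walls `-s` and `m - s`. -/
noncomputable def stripDet (p n : ℕ) (m s : ℤ) : ℝ :=
  Matrix.det (Matrix.of fun i j : Fin p =>
    periodicBridge n m ((j : ℤ) - i) - periodicBridge n m ((i : ℤ) + j + s))

lemma strictMono_two_mul (p : ℕ) : StrictMono fun i : Fin p => 2 * (i : ℤ) := by
  intro i j hij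
  have : (i : ℕ) < j := hij
  simp only
  omega

/-- The kernel is the periodised walk count minus its mirror image in the lower wall. By evenness or
periodicity it vanishes at both walls. The formula is also needed for strips too narrow for the
starting points, where the determinant must be shown to vanish. -/
theorem card_pathFamilies_eq_stripDet {p : ℕ} (hp : 0 < p) (n : ℕ) {m s : ℤ} (hm : 0 < m)
    (hs : 0 ≤ s) (hsm : s ≤ m) :
    ((pathFamilies (2 * n) (-s) (m - s) (fun i : Fin p => 2 * (i : ℤ))
      (fun i => 2 * (i : ℤ))).card : ℝ) = stripDet p n m s := by
  by_cases hI : ∀ i : Fin p, -s < 2 * (i : ℤ) ∧ 2 * (i : ℤ) < m - s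
  · have hm2 : 0 < 2 * m := by omega
    rw [card_pathFamilies_eq_det
      (fun N x z => periodicWalk (2 * m) N (z - x) - periodicWalk (2 * m) N (z + x + 2 * s))]
    · refine congrArg Matrix.det ?_
      ext i j
      simp only [Matrix.of_apply, periodicBridge_eq]
      congr 2 <;> ring
    · intro N x z
      rw [periodicWalk_succ hm2, periodicWalk_succ hm2, show z - x + 1 = z - (x - 1) by ring,
        show z - x - 1 = z - (x + 1) by ring, show z + x + 2 * s + 1 = z + (x + 1) + 2 * s by ring,
        show z + x + 2 * s - 1 = z + (x - 1) + 2 * s by ring]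
      ring
    · intro N z
      rw [sub_eq_zero]
      congr 1
      ring
    · intro N z
      rw [sub_eq_zero, ← periodicWalk_add_period]
      congr 1
      ring
    · intro x z h1 h2 h3 h4
      rw [periodicWalk_zero (abs_lt.2 ⟨by omega, by omega⟩),
        periodicWalk_zero (abs_lt.2 ⟨by omega, by omega⟩)]
      rw [if_neg (show ¬ (z + x + 2 * s = 0) by omega), sub_zero]
      congr 1
      exact propext ⟨fun h => by omega, fun h => by omega⟩
    · exact strictMono_two_mul p
    · exact hI
    · exact strictMono_two_mul p
    · exact hI
    · intro i j
      rw [Int.ModEq]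
      omega
  · rw [pathFamilies_eq_empty (fun h => hI h.1), stripDet, Finset.card_empty, Nat.cast_zero]
    push Not at hI
    obtain ⟨i, hi⟩ := hI
    rcases hs.eq_or_lt with rfl | hs
    · rw [Matrix.det_eq_zero_of_row_eq_zero ⟨0, hp⟩]
      intro j
      simp
    · have hi' := hi (by omega)
      have hip := i.2
      -- Now `m - s ≤ 2(p - 1)`, so both halves of `m - s` are row indices. The points `2a` and `2b`
      -- are mirror images in the upper wall, so their rows are opposite; if `a = b` the row is
      -- zero.
      obtain ⟨a, b, hab⟩ : ∃ a b : Fin p, (a : ℤ) + b = m - s := by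
        refine ⟨⟨((m - s) / 2).toNat, by omega⟩, ⟨(m - s - (m - s) / 2).toNat, by omega⟩, ?_⟩
        simp only
        omega
      have hrow : ∀ j : Fin p,
          periodicBridge n m ((j : ℤ) - a) - periodicBridge n m ((a : ℤ) + j + s)
          = -(periodicBridge n m ((j : ℤ) - b) - periodicBridge n m ((b : ℤ) + j + s)) := by
        intro j
        rw [show (a : ℤ) + j + s = j - b + m by linarith,
          show (b : ℤ) + j + s = j - a + m by linarith, periodicBridge_add_period,
          periodicBridge_add_period]
        ring
      by_cases hne : a = b
      · subst hne
        rw [Matrix.det_eq_zero_of_row_eq_zero a]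
        intro j
        have := hrow j
        rw [Matrix.of_apply]
        linarith
      · symm
        rw [← Matrix.det_updateRow_add_self _ hne]
        refine Matrix.det_eq_zero_of_row_eq_zero a fun j => ?_
        have := hrow j
        rw [Matrix.updateRow_self, Pi.add_apply, Matrix.of_apply, Matrix.of_apply]
        linarith

/-! ### Watermelons and the distribution of their range -/

section Watermelons

variable {p n : ℕ} {W : Fin p → Fin (2 * n + 1) → ℤ}

lemma watermelons_strictMono (hW : W ∈ watermelons p n) (k : Fin (2 * n + 1)) :
    StrictMono (fun i => W i k) ∧ ∀ i j, W i k ≡ W j k [ZMOD 2] := by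
  obtain ⟨h0, -, hstep, hne⟩ := hW
  induction k using Fin.induction with
  | zero =>
    refine ⟨fun i j hij => ?_, fun i j => ?_⟩
    · simp only [h0]
      exact strictMono_two_mul p hij
    · rw [h0, h0, Int.ModEq]
      omega
  | succ k ih =>
    have hs := fun i => hstep i k
    refine ⟨strictMono_add_step ih.1 ih.2 hs fun i j hij => ?_, modEq_add_step ih.2 hs⟩
    by_contra hcon
    exact hne _ i j hcon hij

lemma watermelons_abs_le (hW : W ∈ watermelons p n) (i : Fin p) (k : Fin (2 * n + 1)) :
    |W i k - 2 * i| ≤ k := by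
  obtain ⟨h0, -, hstep, -⟩ := hW
  induction k using Fin.induction with
  | zero => simp [h0]
  | succ k ih =>
    rw [abs_le] at ih ⊢
    have := hstep i k
    simp only [Fin.val_succ, Fin.val_castSucc] at ih ⊢
    push_cast
    omega

lemma swap_mem_pathFamilies_iff {α β : ℤ} :
    (fun k i => W i k) ∈ pathFamilies (2 * n) α β (fun i : Fin p => 2 * (i : ℤ))
      (fun i => 2 * (i : ℤ)) ↔ W ∈ watermelons p n ∧ ∀ k i, α < W i k ∧ W i k < β := by
  rw [mem_pathFamilies]
  constructor
  · rintro ⟨h1, h2, h3, h4, h5⟩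
    exact ⟨⟨congrFun h2, congrFun h3, fun i k => h4 k i, fun k i j hij h => hij (h5 k h)⟩, h1⟩
  · rintro ⟨⟨h2, h3, h4, h5⟩, h1⟩
    refine ⟨h1, funext h2, funext h3, fun k i => h4 i k, fun k i j h => ?_⟩
    by_contra hcon
    exact h5 k i j hcon h

lemma watermelons_wide (hW : W ∈ watermelons p n) (k : Fin (2 * n + 1)) (i : Fin p) :
    -(2 * n + 2 * p + 1 : ℤ) < W i k ∧ W i k < 2 * n + 2 * p + 1 := by
  have h1 := abs_le.1 (watermelons_abs_le hW i k)
  have h2 := k.2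
  have h3 := i.2
  omega

variable (p n) in
lemma watermelons_finite : (watermelons p n).Finite := by
  refine ((pathFamilies (2 * n) (-(2 * n + 2 * p + 1 : ℤ)) (2 * n + 2 * p + 1)
    (fun i : Fin p => 2 * (i : ℤ)) (fun i => 2 * (i : ℤ))).finite_toSet.preimage
    (f := fun W k i => W i k) ?_).subset fun W hW => ?_
  · intro V _ W _ h
    funext i k
    exact congrFun (congrFun h k) i
  · exact swap_mem_pathFamilies_iff.2 ⟨hW, watermelons_wide hW⟩

variable (p n) in
/-- The finite set of watermelons. -/
noncomputable def watermelonFinset : Finset (Fin p → Fin (2 * n + 1) → ℤ) :=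
  (watermelons_finite p n).toFinset

lemma mem_watermelonFinset : W ∈ watermelonFinset p n ↔ W ∈ watermelons p n := by
  simp [watermelonFinset]

lemma watermelons_between_iff (hp : 0 < p) (hW : W ∈ watermelons p n) (α β : ℤ) :
    (∀ k i, α < W i k ∧ W i k < β) ↔ α < watermelonBottom hp W ∧ watermelonHeight hp W < β := by
  rw [watermelonBottom, watermelonHeight, Finset.lt_inf'_iff, Finset.sup'_lt_iff]
  constructor
  · exact fun h => ⟨fun k _ => (h k _).1, fun k _ => (h k _).2⟩
  · intro h k i
    have hm := (watermelons_strictMono hW k).1.monotone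
    exact ⟨(h.1 k (Finset.mem_univ _)).trans_le (hm (Nat.zero_le _)),
      (hm (Nat.le_sub_one_of_lt i.2)).trans_lt (h.2 k (Finset.mem_univ _))⟩

lemma watermelonBottom_nonpos (hp : 0 < p) (hW : W ∈ watermelons p n) :
    watermelonBottom hp W ≤ 0 := by
  have := Finset.inf'_le (W ⟨0, hp⟩) (Finset.mem_univ (0 : Fin (2 * n + 1)))
  rw [hW.1] at this
  exact this.trans_eq (by simp)

lemma watermelonHeight_nonneg (hp : 0 < p) (hW : W ∈ watermelons p n) :
    0 ≤ watermelonHeight hp W := by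
  have := Finset.le_sup' (W ⟨p - 1, Nat.sub_lt hp Nat.one_pos⟩)
    (Finset.mem_univ (0 : Fin (2 * n + 1)))
  rw [hW.1] at this
  exact le_trans (by positivity) this

lemma card_watermelons_between (hp : 0 < p) (n : ℕ) (α β : ℤ) :
    ({W ∈ watermelonFinset p n | α < watermelonBottom hp W ∧ watermelonHeight hp W < β}).card
      = (pathFamilies (2 * n) α β (fun i : Fin p => 2 * (i : ℤ)) (fun i => 2 * (i : ℤ))).card := by
  refine Finset.card_nbij' (fun W k i => W i k) (fun W i k => W k i) ?_ ?_ (fun _ _ => rfl)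
    (fun _ _ => rfl)
  · intro W hW
    simp only [Finset.coe_filter, Set.mem_ofPred_eq, mem_watermelonFinset] at hW
    exact swap_mem_pathFamilies_iff.2 ⟨hW.1, (watermelons_between_iff hp hW.1 _ _).2 hW.2⟩
  · intro W hW
    have h := swap_mem_pathFamilies_iff.1 hW
    simp only [Finset.coe_filter, Set.mem_ofPred_eq, mem_watermelonFinset]
    exact ⟨h.1, (watermelons_between_iff hp h.1 _ _).1 h.2⟩

end Watermelons

/-- Raising the upper wall from `m - s` to `m + 1 - s` adds precisely the case `H = m - s`. Only `s
= m - H` contributes, and there the condition at the lower wall reads `H - B < m`. -/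
lemma sum_between_sub (m : ℕ) {B H : ℤ} (hH : 0 ≤ H)
    (hB : B ≤ 0) :
    ∑ s ∈ Finset.range (m + 1), ((if -(s : ℤ) < B ∧ H < (m + 1 : ℤ) - s then (1 : ℝ) else 0)
      - if -(s : ℤ) < B ∧ H < (m : ℤ) - s then 1 else 0) = if H - B < m then 1 else 0 := by
  have hterm : ∀ s : ℕ, ((if -(s : ℤ) < B ∧ H < (m + 1 : ℤ) - s then (1 : ℝ) else 0)
      - if -(s : ℤ) < B ∧ H < (m : ℤ) - s then 1 else 0)
      = if (s : ℤ) = m - H then (if H - B < m then 1 else 0) else 0 := by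
    intro s
    split_ifs <;> first | omega | norm_num
  simp_rw [hterm]
  by_cases hm : H ≤ m
  · obtain ⟨h, rfl⟩ := Int.eq_ofNat_of_zero_le hH
    rw [Finset.sum_eq_single (m - h)]
    · rw [if_pos (by omega)]
    · intro b _ hb
      rw [if_neg (by omega)]
    · intro hb
      simp at hb
  · rw [Finset.sum_eq_zero]
    · rw [if_neg (by omega)]
    · intro s _
      rw [if_neg (by omega)]

theorem card_watermelonRange_lt {p : ℕ} (hp : 0 < p) (n : ℕ) {m : ℕ} (hm : 0 < m) :
    (({W ∈ watermelonFinset p n | watermelonRange hp W < m}).card : ℝ)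
      = ∑ s ∈ Finset.range (m + 1), (stripDet p n (m + 1) s - stripDet p n m s) := by
  have h1 : ∀ s ∈ Finset.range (m + 1), stripDet p n (m + 1) s - stripDet p n m s
      = ∑ W ∈ watermelonFinset p n,
        ((if -(s : ℤ) < watermelonBottom hp W ∧ watermelonHeight hp W < (m + 1 : ℤ) - s
          then (1 : ℝ) else 0)
        - if -(s : ℤ) < watermelonBottom hp W ∧ watermelonHeight hp W < (m : ℤ) - s
          then 1 else 0) := by
    intro s hs
    rw [Finset.mem_range] at hs
    rw [← card_pathFamilies_eq_stripDet hp n (by omega) (by omega) (by omega),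
      ← card_pathFamilies_eq_stripDet hp n (by omega) (by omega) (by omega),
      ← card_watermelons_between, ← card_watermelons_between, Finset.sum_sub_distrib,
      Finset.sum_boole, Finset.sum_boole]
  rw [Finset.sum_congr rfl h1, Finset.sum_comm, Finset.card_filter]
  push_cast
  refine Finset.sum_congr rfl fun W hW => ?_
  rw [mem_watermelonFinset] at hW
  rw [sum_between_sub m (watermelonHeight_nonneg hp hW) (watermelonBottom_nonpos hp hW)]
  rfl

lemma periodicBridge_of_lt {n : ℕ} {m k : ℤ} (h : n + |k| < m) :
    periodicBridge n m k = bridgeCount n k := by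
  rw [periodicBridge, tsum_eq_single 0]
  · simp
  · intro l hl
    refine bridgeCount_eq_zero ?_
    have hk := abs_nonneg k
    have h1 : m ≤ |l * m| := by
      rw [abs_mul, abs_of_pos (a := m) (by omega)]
      have : 1 ≤ |l| := Int.one_le_abs hl
      nlinarith
    have := abs_sub (l * m + k) k
    rw [add_sub_cancel_right] at this
    linarith

theorem card_watermelonFinset {p : ℕ} (hp : 0 < p) (n : ℕ) :
    ((watermelonFinset p n).card : ℝ)
      = Matrix.det (Matrix.of fun i j : Fin p => bridgeCount n ((j : ℤ) - i)) := by
  -- Walls at distance `L` are never reached. In the Toeplitz part only the image `l = 0` survives,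
  -- and the Hankel part vanishes.
  set L : ℤ := 2 * n + 2 * p + 1
  have h1 := card_watermelons_between hp n (-L) (2 * L - L)
  have h2 := card_pathFamilies_eq_stripDet hp n (m := 2 * L) (s := L) (by omega) (by omega)
    (by omega)
  rw [← h1] at h2
  rw [Finset.filter_true_of_mem] at h2
  · rw [h2]
    refine congrArg Matrix.det ?_
    ext i j
    have hi := i.2
    have hj := j.2
    have e1 : periodicBridge n (2 * L) ((j : ℤ) - i) = bridgeCount n ((j : ℤ) - i) := by
      apply periodicBridge_of_lt
      rcases abs_cases ((j : ℤ) - i) with h | h <;> omega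
    have e2 : periodicBridge n (2 * L) ((i : ℤ) + j + L) = 0 := by
      rw [periodicBridge_of_lt, bridgeCount_eq_zero]
      · rw [abs_of_nonneg] <;> omega
      · rw [abs_of_nonneg] <;> omega
    rw [Matrix.of_apply, Matrix.of_apply, e1, e2, sub_zero]
  · intro W hW
    rw [mem_watermelonFinset] at hW
    rw [← watermelons_between_iff hp hW]
    intro k i
    have := watermelons_wide hW k i
    omega

theorem watermelonMeasure_real_range_le {p : ℕ} (hp : 0 < p) {n : ℕ} (hn : 0 < n) (t : ℝ) :
    (watermelonMeasure p n).real {W | ((watermelonRange hp W : ℝ) + 1) / √(n : ℝ) ≤ t}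
      = ({W ∈ watermelonFinset p n | watermelonRange hp W < ⌊t * √(n : ℝ)⌋}).card
        / (watermelonFinset p n).card := by
  classical
  have hs : 0 < √(n : ℝ) := Real.sqrt_pos.2 (by exact_mod_cast hn)
  have e1 : watermelons p n = (watermelonFinset p n : Set _) := by
    ext W; simp [mem_watermelonFinset]
  have e2 : (watermelonFinset p n : Set (Fin p → Fin (2 * n + 1) → ℤ)) ∩
      {W | ((watermelonRange hp W : ℝ) + 1) / √(n : ℝ) ≤ t}
      = (↑((watermelonFinset p n).filter fun W => watermelonRange hp W < ⌊t * √(n : ℝ)⌋) :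
        Set (Fin p → Fin (2 * n + 1) → ℤ)) := by
    ext W
    simp only [Set.mem_inter_iff, Finset.coe_filter, Set.mem_ofPred_eq, Finset.mem_coe]
    rw [div_le_iff₀ hs, ← Int.add_one_le_iff, Int.le_floor]
    push_cast
    rfl
  rw [watermelonMeasure, MeasureTheory.measureReal_def, e1,
    ← ProbabilityTheory.uniformOn_inter_self (Finset.finite_toSet _), e2,
    ProbabilityTheory.uniformOn_apply_finset, ENNReal.toReal_div,
    Finset.inter_eq_right.2 (Finset.filter_subset _ _)]
  simp

/-! ### Differencing the determinants -/

/-- The coefficients of the `a`-th iterated forward difference. -/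
def diffCoeff (a i : ℕ) : ℝ := (-1) ^ (a - i) * a.choose i

lemma sum_diffCoeff_mul {p : ℕ} (f : ℤ → ℝ) (a : Fin p) (k : ℤ) :
    ∑ i : Fin p, diffCoeff a i * f (k + i) = Δ_[1] ^[a] f k := by
  rw [fwdDiff_iter_eq_sum_shift, Fin.sum_univ_eq_sum_range (fun i => diffCoeff a i * f (k + i)) p]
  symm
  refine Finset.sum_subset_zero_on_sdiff (Finset.range_subset_range.2 a.2) ?_ ?_
  · intro i hi
    rw [Finset.mem_sdiff, Finset.mem_range, Finset.mem_range] at hi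
    rw [diffCoeff, Nat.choose_eq_zero_of_lt (by omega)]
    simp
  · intro i _
    simp [diffCoeff]

lemma fwdDiff_iter_comp_neg (f : ℤ → ℝ) (a : ℕ) (k : ℤ) :
    Δ_[1] ^[a] (fun j => f (-j)) k = (-1) ^ a * Δ_[1] ^[a] f (-k - a) := by
  induction a generalizing k with
  | zero => simp
  | succ a ih =>
    rw [fwdDiff_iter_succ_apply, fwdDiff_iter_succ_apply, ih, ih]
    push_cast
    rw [show -(k + 1) - (a : ℤ) = -k - (a + 1) by ring,
      show -k - ((a : ℤ) + 1) + 1 = -k - a by ring]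
    ring

lemma det_diffCoeff (p : ℕ) : Matrix.det (Matrix.of fun a i : Fin p => diffCoeff a i) = 1 := by
  rw [Matrix.det_of_isLowerTriangular]
  · simp [diffCoeff]
  · intro i j hij
    have hij' : (i : ℕ) < j := hij
    simp [diffCoeff, Nat.choose_eq_zero_of_lt hij']

/-- Row and column differencing of a Toeplitz minus Hankel determinant. -/
lemma det_toeplitz_sub_hankel (p : ℕ) (f g : ℤ → ℝ) :
    Matrix.det (Matrix.of fun i j : Fin p => f ((j : ℤ) - i) - g ((i : ℤ) + j))
      = Matrix.det (Matrix.of fun a b : Fin p =>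
        (-1) ^ (a : ℕ) * Δ_[1] ^[(a + b : ℕ)] f (-(a : ℤ)) - Δ_[1] ^[(a + b : ℕ)] g 0) := by
  set U : Matrix (Fin p) (Fin p) ℝ := Matrix.of fun a i => diffCoeff a i with hU
  set M : Matrix (Fin p) (Fin p) ℝ :=
    Matrix.of fun i j : Fin p => f ((j : ℤ) - i) - g ((i : ℤ) + j) with hM
  -- `U` is unitriangular, and multiplication by `U` and its transpose takes differences in `i` and
  -- in `j`. The Toeplitz part depends on `j - i`, so differencing in `i` runs backwards; this
  -- produces the sign `(-1) ^ a` and the argument `-a`.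
  have h : Matrix.det (U * (M * U.transpose)) = Matrix.det M := by
    rw [Matrix.det_mul, Matrix.det_mul, Matrix.det_transpose, det_diffCoeff]
    ring
  rw [← h]
  congr 1
  ext a b
  have h1 : ∀ i : Fin p, (M * U.transpose) i b
      = Δ_[1] ^[b] f (-((0 : ℤ) + i)) - Δ_[1] ^[b] g ((0 : ℤ) + i) := by
    intro i
    rw [Matrix.mul_apply, ← sum_diffCoeff_mul, ← sum_diffCoeff_mul, ← Finset.sum_sub_distrib]
    refine Finset.sum_congr rfl fun j _ => ?_
    simp only [hM, hU, Matrix.of_apply, Matrix.transpose_apply]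
    rw [show (j : ℤ) - i = -(0 + i) + j by ring, show (i : ℤ) + j = 0 + i + j by ring]
    ring
  rw [Matrix.mul_apply, Matrix.of_apply]
  simp_rw [h1, mul_sub]
  rw [Finset.sum_sub_distrib]
  congr 1
  · refine (sum_diffCoeff_mul (fun j => Δ_[1] ^[(b : ℕ)] f (-j)) a 0).trans ?_
    rw [fwdDiff_iter_comp_neg, ← Function.iterate_add_apply]
    simp
  · refine (sum_diffCoeff_mul (Δ_[1] ^[(b : ℕ)] g) a 0).trans ?_
    rw [← Function.iterate_add_apply]

lemma summable_fwdDiff_bridgeCount (n : ℕ) {m : ℤ} (hm : 0 < m) (a : ℕ) (k : ℤ) :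
    Summable fun l : ℤ => Δ_[1] ^[a] (bridgeCount n) (l * m + k) := by
  induction a generalizing k with
  | zero =>
    refine (summable_walkCount (m := 2 * m) (by omega) (2 * n) (2 * k)).congr fun l => ?_
    rw [Function.iterate_zero, id, bridgeCount]
    congr 1
    ring
  | succ a ih =>
    refine ((ih (k + 1)).sub (ih k)).congr fun l => ?_
    rw [fwdDiff_iter_succ_apply, add_assoc]

lemma fwdDiff_iter_periodicBridge (n : ℕ) {m : ℤ} (hm : 0 < m) (a : ℕ) (k : ℤ) :
    Δ_[1] ^[a] (periodicBridge n m) k = ∑' l : ℤ, Δ_[1] ^[a] (bridgeCount n) (l * m + k) := by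
  induction a generalizing k with
  | zero => rfl
  | succ a ih =>
    rw [fwdDiff_iter_succ_apply, ih, ih, ← (summable_fwdDiff_bridgeCount n hm a _).tsum_sub
      (summable_fwdDiff_bridgeCount n hm a _)]
    refine tsum_congr fun l => ?_
    rw [fwdDiff_iter_succ_apply, add_assoc]

/-- The periodised scaled differences. -/
noncomputable def periodicDiff (n a : ℕ) (m k : ℤ) : ℝ := ∑' l : ℤ, scaledDiff n a (l * m + k)

/-- The entries of the rescaled strip determinant after row and column differencing. -/
noncomputable def stripEntry {p : ℕ} (n : ℕ) (m s : ℤ) (a b : Fin p) : ℝ :=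
  (-1) ^ (a : ℕ) * periodicDiff n (a + b) m (-(a : ℤ)) - periodicDiff n (a + b) m s

/-- The normalising factor of the rescaled strip determinant. -/
noncomputable def stripScale (p n : ℕ) : ℝ :=
  (∏ i : Fin p, √(n : ℝ) ^ (i : ℕ)) * ∏ i : Fin p, (√(n : ℝ) ^ (i : ℕ) / bridgeCount n 0)

lemma stripScale_pos (p : ℕ) {n : ℕ} (hn : 0 < n) : 0 < stripScale p n := by
  have hs : 0 < √(n : ℝ) := Real.sqrt_pos.2 (by exact_mod_cast hn)
  have := bridgeCount_zero_pos n
  rw [stripScale]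
  positivity

lemma stripScale_mul_det {p : ℕ} (n : ℕ) (M : Fin p → Fin p → ℝ) :
    stripScale p n * Matrix.det (Matrix.of M) = Matrix.det (Matrix.of fun a b : Fin p =>
      √(n : ℝ) ^ (a + b : ℕ) * M a b / bridgeCount n 0) := by
  rw [stripScale, mul_assoc, ← Matrix.det_mul_row, ← Matrix.det_mul_column]
  congr 1
  ext a b
  simp only [Matrix.of_apply, pow_add]
  ring

lemma stripScale_mul_stripDet (p n : ℕ) {m : ℤ} (hm : 0 < m) (s : ℤ) :
    stripScale p n * stripDet p n m s = Matrix.det (Matrix.of (stripEntry (p := p) n m s)) := by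
  have hg : ∀ a (k : ℤ), Δ_[1] ^[a] (fun k => periodicBridge n m (k + s)) k
      = Δ_[1] ^[a] (periodicBridge n m) (k + s) := by
    intro a
    induction a with
    | zero => exact fun k => rfl
    | succ a ih =>
      intro k
      rw [fwdDiff_iter_succ_apply, fwdDiff_iter_succ_apply, ih, ih, add_right_comm]
  rw [stripDet, det_toeplitz_sub_hankel p (periodicBridge n m)
    (fun k => periodicBridge n m (k + s)), stripScale_mul_det]
  congr 1
  ext a b
  simp only [Matrix.of_apply, stripEntry, periodicDiff, scaledDiff, hg,
    fwdDiff_iter_periodicBridge n hm, tsum_div_const, tsum_mul_left, zero_add]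
  ring

lemma stripScale_mul_card_watermelonFinset {p : ℕ} (hp : 0 < p) (n : ℕ) :
    stripScale p n * (watermelonFinset p n).card = Matrix.det (Matrix.of fun a b : Fin p =>
      (-1) ^ (a : ℕ) * scaledDiff n (a + b) (-(a : ℤ))) := by
  have h := det_toeplitz_sub_hankel p (bridgeCount n) 0
  have h0 : ∀ a, Δ_[1] ^[a] (0 : ℤ → ℝ) 0 = 0 := by
    intro a
    have : ∀ k : ℤ, Δ_[1] ^[a] (0 : ℤ → ℝ) k = 0 := by
      induction a with
      | zero => exact fun k => rfl
      | succ a ih => intro k; rw [fwdDiff_iter_succ_apply, ih, ih, sub_zero]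
    exact this 0
  simp only [Pi.zero_apply, sub_zero, h0] at h
  rw [card_watermelonFinset hp, h, stripScale_mul_det]
  congr 1
  ext a b
  simp only [Matrix.of_apply, scaledDiff]
  ring

/-! ### Lattice sums of Gaussian derivatives -/

/-- The `a`-th derivative of `exp (-x ^ 2)`. -/
noncomputable def gaussDeriv (a : ℕ) (x : ℝ) : ℝ := (-1) ^ a * hermiteGauss a x

lemma gaussDeriv_hasDerivAt (a : ℕ) (x : ℝ) :
    HasDerivAt (gaussDeriv a) (gaussDeriv (a + 1) x) x := by
  refine ((hermiteGauss_hasDerivAt a x).const_mul ((-1) ^ a)).congr_deriv ?_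
  rw [gaussDeriv, pow_succ]
  ring

lemma tendsto_natCast_sqrt : Tendsto (fun n : ℕ => √(n : ℝ)) atTop atTop :=
  Real.tendsto_sqrt_atTop.comp tendsto_natCast_atTop_atTop

lemma tendsto_floor_mul_sqrt_div (x : ℝ) :
    Tendsto (fun n : ℕ => (⌊x * √(n : ℝ)⌋ : ℝ) / √(n : ℝ)) atTop (𝓝 x) := by
  have hs : Tendsto (fun n : ℕ => x - (√(n : ℝ))⁻¹) atTop (𝓝 x) := by
    simpa using tendsto_natCast_sqrt.inv_tendsto_atTop.const_sub x
  refine tendsto_of_tendsto_of_tendsto_of_le_of_le' hs tendsto_const_nhds ?_ ?_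
  · filter_upwards [eventually_gt_atTop 0] with n hn
    have hs : 0 < √(n : ℝ) := Real.sqrt_pos.2 (by exact_mod_cast hn)
    rw [le_div_iff₀ hs, sub_mul, inv_mul_cancel₀ hs.ne']
    exact (Int.sub_one_lt_floor _).le
  · filter_upwards [eventually_gt_atTop 0] with n hn
    have hs : 0 < √(n : ℝ) := Real.sqrt_pos.2 (by exact_mod_cast hn)
    rw [div_le_iff₀ hs]
    exact Int.floor_le _

/-- The uniform decay of the scaled differences survives the local limit. -/
lemma exists_gaussDeriv_decay (a q : ℕ) : ∃ C : ℝ, ∀ x : ℝ,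
    (1 + |x|) ^ q * |gaussDeriv a x| ≤ C := by
  obtain ⟨C, hC⟩ := exists_scaledDiff_decay a q
  refine ⟨C, fun x => ?_⟩
  have hx := tendsto_floor_mul_sqrt_div x
  have h1 := tendsto_scaledDiff a hx
  refine le_of_tendsto (((hx.abs.const_add 1).pow q).mul h1.abs) ?_
  filter_upwards [eventually_gt_atTop 0] with n hn
  have := hC n hn ⌊x * √(n : ℝ)⌋
  rwa [abs_div, abs_of_nonneg (Real.sqrt_nonneg _)]

lemma one_add_abs_le_mul (x w : ℝ) : 1 + |x| ≤ (1 + |x + w|) * (1 + |w|) := by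
  have := abs_sub (x + w) w
  rw [add_sub_cancel_right] at this
  nlinarith [mul_nonneg (abs_nonneg (x + w)) (abs_nonneg w)]

lemma summable_inv_one_add_abs_sq : Summable fun l : ℤ => 1 / (1 + |(l : ℝ)|) ^ 2 := by
  have h : Summable fun n : ℕ => 1 / (1 + (n : ℝ)) ^ 2 := by
    have := (summable_nat_add_iff 1).2 (Real.summable_one_div_nat_pow.2 one_lt_two)
    refine this.congr fun n => ?_
    push_cast
    rw [add_comm]
  refine Summable.of_nat_of_neg (h.congr fun n => ?_) (h.congr fun n => ?_) <;> simp

/-- If `x + w` is far from the origin then a rapidly decaying quantity at `x + w` is small. -/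
lemma decay_transfer {C c R F x w : ℝ} {l : ℤ} (hc : 0 < c) (hF : 0 ≤ F)
    (h : (1 + |x + w|) ^ 3 * F ≤ C) (hx : c * |(l : ℝ)| ≤ |x|) (hw : |w| ≤ R) :
    (1 + |(l : ℝ)|) * F ≤ C * ((1 + 1 / c) * (1 + R)) ^ 3 * (1 / (1 + |(l : ℝ)|) ^ 2) := by
  have hR : 0 ≤ R := (abs_nonneg w).trans hw
  have hl := abs_nonneg (l : ℝ)
  have h1 : 1 + |(l : ℝ)| ≤ (1 + |x + w|) * ((1 + 1 / c) * (1 + R)) := by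
    calc 1 + |(l : ℝ)| ≤ (1 + 1 / c) * (1 + c * |(l : ℝ)|) := by
          have e : (1 + 1 / c) * (1 + c * |(l : ℝ)|) = 1 + |(l : ℝ)| + (1 / c + c * |(l : ℝ)|) := by
            field_simp
            ring
          have : 0 ≤ 1 / c + c * |(l : ℝ)| := by positivity
          linarith
      _ ≤ (1 + 1 / c) * ((1 + |x + w|) * (1 + R)) := by
          gcongr
          refine le_trans (by linarith) ((one_add_abs_le_mul x w).trans ?_)
          gcongr
      _ = _ := by ring
  rw [mul_one_div, le_div_iff₀ (by positivity)]
  calc (1 + |(l : ℝ)|) * F * (1 + |(l : ℝ)|) ^ 2 = (1 + |(l : ℝ)|) ^ 3 * F := by ring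
    _ ≤ ((1 + |x + w|) * ((1 + 1 / c) * (1 + R))) ^ 3 * F := by gcongr
    _ = ((1 + |x + w|) ^ 3 * F) * ((1 + 1 / c) * (1 + R)) ^ 3 := by ring
    _ ≤ _ := by gcongr

/-- The spare factor `1 + |l|` absorbs the `l` produced by differentiating in the lattice spacing.
-/
lemma exists_gaussDeriv_lattice_bound (a : ℕ) {c : ℝ} (hc : 0 < c) (R : ℝ) : ∃ C : ℝ,
    ∀ (l : ℤ) (z w : ℝ), c ≤ z → |w| ≤ R →
      (1 + |(l : ℝ)|) * |gaussDeriv a (l * z + w)| ≤ C * (1 / (1 + |(l : ℝ)|) ^ 2) := by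
  obtain ⟨C, hC⟩ := exists_gaussDeriv_decay a 3
  refine ⟨_, fun l z w hz hw => decay_transfer hc (abs_nonneg _) (hC _) ?_ hw⟩
  rw [abs_mul, mul_comm, abs_of_pos (hc.trans_le hz)]
  gcongr

/-- The point `y` need not be `l * m`: the bound must also cover the points between `l * m` and `l *
(m + 1)` that arise on telescoping. -/
lemma exists_scaledDiff_lattice_bound (a : ℕ) {c : ℝ} (hc : 0 < c) (R : ℝ) : ∃ C : ℝ,
    ∀ (n : ℕ) (l m y s : ℤ), 0 < n → c ≤ m / √(n : ℝ) → |(s : ℝ) / √(n : ℝ)| ≤ R → |l| * m ≤ |y| →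
      (1 + |(l : ℝ)|) * |scaledDiff n a (y + s)| ≤ C * (1 / (1 + |(l : ℝ)|) ^ 2) := by
  obtain ⟨C, hC⟩ := exists_scaledDiff_decay a 3
  refine ⟨_, fun n l m y s hn hm hs hy =>
    decay_transfer (C := C) (x := y / √(n : ℝ)) hc (abs_nonneg _) ?_ ?_ hs⟩
  · have := hC n hn (y + s)
    rw [← add_div, abs_div _ √(n : ℝ), abs_of_nonneg (Real.sqrt_nonneg _)]
    push_cast at this
    exact this
  · rw [abs_div, abs_of_nonneg (Real.sqrt_nonneg _)]
    have hy' : |(l : ℝ)| * m ≤ |(y : ℝ)| := by exact_mod_cast hy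
    calc c * |(l : ℝ)| ≤ m / √(n : ℝ) * |(l : ℝ)| := by gcongr
      _ = |(l : ℝ)| * m / √(n : ℝ) := by ring
      _ ≤ _ := by gcongr

lemma abs_le_of_one_add_abs_mul_le {l x C : ℝ} (h : (1 + |l|) * |x| ≤ C) : |x| ≤ C := by
  nlinarith [mul_nonneg (abs_nonneg l) (abs_nonneg x)]

lemma summable_gaussDeriv (a : ℕ) {z : ℝ} (hz : 0 < z) (w : ℝ) :
    Summable fun l : ℤ => gaussDeriv a (l * z + w) := by
  obtain ⟨C, hC⟩ := exists_gaussDeriv_lattice_bound a hz |w|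
  refine Summable.of_norm_bounded (summable_inv_one_add_abs_sq.mul_left C) fun l => ?_
  exact abs_le_of_one_add_abs_mul_le (hC l z w le_rfl le_rfl)

/-- The lattice sum of the derivatives of the Gaussian. -/
noncomputable def gaussLatticeSum (a : ℕ) (z w : ℝ) : ℝ := ∑' l : ℤ, gaussDeriv a (l * z + w)

/-- The derivative of `gaussLatticeSum` with respect to the lattice spacing. -/
noncomputable def gaussLatticeSumDeriv (a : ℕ) (z w : ℝ) : ℝ :=
  ∑' l : ℤ, l * gaussDeriv (a + 1) (l * z + w)

lemma gaussLatticeSum_hasDerivAt (a : ℕ) {t : ℝ} (ht : 0 < t) (w : ℝ) :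
    HasDerivAt (fun z => gaussLatticeSum a z w) (gaussLatticeSumDeriv a t w) t := by
  obtain ⟨C, hC⟩ := exists_gaussDeriv_lattice_bound (a + 1) (half_pos ht) |w|
  refine hasDerivAt_tsum_of_isPreconnected (t := Set.Ioi (t / 2)) (y₀ := t)
    (summable_inv_one_add_abs_sq.mul_left C) isOpen_Ioi isPreconnected_Ioi
    (g := fun (l : ℤ) z => gaussDeriv a (l * z + w))
    (g' := fun (l : ℤ) z => l * gaussDeriv (a + 1) (l * z + w)) ?_ ?_ (half_lt_self ht)
    (summable_gaussDeriv a ht w) (half_lt_self ht)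
  · intro l z _
    have h := (gaussDeriv_hasDerivAt a (l * z + w)).comp z
      (((hasDerivAt_id z).const_mul (l : ℝ)).add_const w)
    refine h.congr_deriv ?_
    ring
  · intro l z hz
    rw [Real.norm_eq_abs, abs_mul]
    refine le_trans ?_ (hC l z w (le_of_lt hz) le_rfl)
    gcongr
    linarith

lemma summable_scaledDiff (n a : ℕ) {m : ℤ} (hm : 0 < m) (k : ℤ) :
    Summable fun l : ℤ => scaledDiff n a (l * m + k) := by
  simp only [scaledDiff]
  exact ((summable_fwdDiff_bridgeCount n hm a k).mul_left _).div_const _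

/-- From `l * m` to `l * (m + 1)` there are `|l|` unit steps, and `√n` times each increment is a
scaled difference of the next order. For negative `l` the walk starts at `l * (m + 1)`, hence `min l
0` and the sign. -/
lemma sqrt_mul_scaledDiff_sub (n a : ℕ) (l m s : ℤ) :
    √(n : ℝ) * (scaledDiff n a (l * (m + 1) + s) - scaledDiff n a (l * m + s))
      = l.sign * ∑ u ∈ Finset.range l.natAbs,
        scaledDiff n (a + 1) ((l * m + min l 0 + u) + s) := by
  have key : ∀ (d : ℕ) (k : ℤ), ∑ u ∈ Finset.range d, scaledDiff n (a + 1) (k + u)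
      = √(n : ℝ) * (scaledDiff n a (k + d) - scaledDiff n a k) := by
    intro d k
    have := Finset.sum_range_sub (fun u : ℕ => scaledDiff n a (k + u)) d
    simp only [Nat.cast_zero, add_zero] at this
    rw [← this, Finset.mul_sum]
    refine Finset.sum_congr rfl fun u _ => ?_
    rw [scaledDiff_succ]
    push_cast
    rw [add_assoc]
  have e : ∀ u : ℕ, l * m + min l 0 + u + s = l * m + min l 0 + s + u := fun u => by ring
  simp_rw [e]
  rw [key]
  obtain ⟨d, rfl | rfl⟩ := l.eq_nat_or_neg
  · rcases Nat.eq_zero_or_pos d with rfl | hd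
    · simp
    · rw [Int.sign_eq_one_of_pos (by exact_mod_cast hd), min_eq_right (by positivity),
        Int.natAbs_natCast, show (d : ℤ) * m + 0 + s + d = d * (m + 1) + s by ring,
        show (d : ℤ) * m + 0 + s = d * m + s by ring]
      simp
  · rcases Nat.eq_zero_or_pos d with rfl | hd
    · simp
    · rw [Int.sign_eq_neg_one_of_neg (by omega), min_eq_left (by omega), Int.natAbs_neg,
        Int.natAbs_natCast, show -(d : ℤ) * m + -d + s + d = -d * m + s by ring,
        show -(d : ℤ) * m + -d + s = -d * (m + 1) + s by ring]
      push_cast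
      ring

/-- The `|l|` terms of the telescoped sum are paid for by the spare factor `1 + |l|` of
`exists_scaledDiff_lattice_bound`. -/
lemma exists_scaledDiff_sub_bound (a : ℕ) {c : ℝ} (hc : 0 < c) (R : ℝ) : ∃ C : ℝ,
    ∀ (n : ℕ) (l m s : ℤ), 0 < n → c ≤ m / √(n : ℝ) → |(s : ℝ) / √(n : ℝ)| ≤ R →
      |√(n : ℝ) * (scaledDiff n a (l * (m + 1) + s) - scaledDiff n a (l * m + s))|
        ≤ C * (1 / (1 + |(l : ℝ)|) ^ 2) := by
  obtain ⟨C, hC⟩ := exists_scaledDiff_lattice_bound (a + 1) hc R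
  refine ⟨C, fun n l m s hn hm hs => ?_⟩
  have hm0 : 0 ≤ m := by
    by_contra hcon
    have : (m : ℝ) / √(n : ℝ) ≤ 0 :=
      div_nonpos_of_nonpos_of_nonneg (by exact_mod_cast (not_le.1 hcon).le) (Real.sqrt_nonneg _)
    linarith
  rw [sqrt_mul_scaledDiff_sub, abs_mul]
  have h0 : 0 ≤ C * (1 / (1 + |(l : ℝ)|) ^ 2) :=
    le_trans (by positivity) (hC n l m (l * m) s hn hm hs (by rw [abs_mul, abs_of_nonneg hm0]))
  have hsign : |(l.sign : ℝ)| ≤ 1 := by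
    rcases lt_trichotomy l 0 with h | h | h
    · simp [Int.sign_eq_neg_one_of_neg h]
    · simp [h]
    · simp [Int.sign_eq_one_of_pos h]
  have hsum : |∑ u ∈ Finset.range l.natAbs,
      scaledDiff n (a + 1) ((l * m + min l 0 + u) + s)| ≤
      l.natAbs * (C * (1 / (1 + |(l : ℝ)|) ^ 2) / (1 + |(l : ℝ)|)) := by
    refine (Finset.abs_sum_le_sum_abs _ _).trans ?_
    rw [← nsmul_eq_mul]
    refine (Finset.sum_le_card_nsmul _ _ _ fun u hu => ?_).trans_eq (by rw [Finset.card_range])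
    rw [le_div_iff₀ (by positivity), mul_comm]
    refine hC n l m _ s hn hm hs ?_
    rw [Finset.mem_range] at hu
    rcases le_or_gt 0 l with hl | hl
    · rw [abs_of_nonneg hl, min_eq_right hl]
      exact le_trans (by omega) (le_abs_self _)
    · rw [abs_of_neg hl, min_eq_left hl.le]
      refine le_trans ?_ (neg_le_abs _)
      have : l + u ≤ 0 := by omega
      linarith
  have hnat : (l.natAbs : ℝ) = |(l : ℝ)| := by rw [Nat.cast_natAbs, Int.cast_abs]
  calc _ ≤ 1 * (l.natAbs * (C * (1 / (1 + |(l : ℝ)|) ^ 2) / (1 + |(l : ℝ)|))) := by gcongr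
    _ ≤ _ := by
      rw [hnat, one_mul, mul_div_assoc', div_le_iff₀ (by positivity)]
      nlinarith [abs_nonneg (l : ℝ)]

/-! ### The Hankel determinant of the Hermite numbers -/

lemma hermiteGauss_zero_add_two (k : ℕ) :
    hermiteGauss (k + 2) 0 = -2 * (k + 1) * hermiteGauss k 0 := by
  rw [hermiteGauss_recurrence]
  push_cast
  simp

/-- The connection coefficients of the Hankel matrix of the Hermite numbers. -/
noncomputable def hermiteLower (i k : ℕ) : ℝ := i.choose k * hermiteGauss (i - k) 0

lemma hermiteLower_of_lt {i k : ℕ} (h : i < k) : hermiteLower i k = 0 := by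
  rw [hermiteLower, Nat.choose_eq_zero_of_lt h]
  simp

lemma hermiteGauss_zero_zero : hermiteGauss 0 0 = 1 := by simp [hermiteGauss, physHermite]

lemma hermiteLower_self (i : ℕ) : hermiteLower i i = 1 := by
  simp [hermiteLower, hermiteGauss_zero_zero]

lemma hermiteLower_succ_zero (i : ℕ) : hermiteLower (i + 1) 0 = -2 * hermiteLower i 1 := by
  rcases i with _ | i
  · have : hermiteGauss 1 0 = 0 := by simp [hermiteGauss, physHermite]
    simp [hermiteLower, this]
  · simp only [hermiteLower, Nat.sub_zero, hermiteGauss_zero_add_two, Nat.choose_zero_right,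
      Nat.choose_one_right, Nat.add_sub_cancel]
    push_cast
    ring

lemma hermiteLower_succ_succ (i k : ℕ) :
    hermiteLower (i + 1) (k + 1) = hermiteLower i k - 2 * (k + 2) * hermiteLower i (k + 2) := by
  simp only [hermiteLower, Nat.choose_succ_succ' i k, Nat.add_sub_add_right]
  rcases lt_or_ge i (k + 2) with h | h
  · rw [Nat.choose_eq_zero_of_lt h]
    rcases lt_or_ge i (k + 1) with h' | h'
    · rw [Nat.choose_eq_zero_of_lt h']
      simp
    · have : hermiteGauss 1 0 = 0 := by simp [hermiteGauss, physHermite]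
      rw [show i - k = 1 by omega, this]
      simp
  · obtain ⟨j, rfl⟩ := Nat.exists_eq_add_of_le h
    have hc := Nat.choose_succ_right_eq (k + 2 + j) (k + 1)
    rw [show k + 2 + j - (k + 1) = j + 1 by omega] at hc
    have hc' : ((k + 2 + j).choose (k + 2) : ℝ) * (k + 2) = (k + 2 + j).choose (k + 1) * (j + 1) := by
      exact_mod_cast hc
    rw [show k + 2 + j - k = j + 2 by omega, show k + 2 + j - (k + 2) = j by omega,
      hermiteGauss_zero_add_two]
    push_cast
    linear_combination 2 * hermiteGauss j 0 * hc'

/-- The diagonal of the factorisation of the Hankel matrix of the Hermite numbers. -/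
noncomputable def hermiteDiag (k : ℕ) : ℝ := (-2) ^ k * k.factorial

lemma hermiteDiag_succ (k : ℕ) : hermiteDiag (k + 1) = -2 * (k + 1) * hermiteDiag k := by
  rw [hermiteDiag, hermiteDiag, Nat.factorial_succ, pow_succ]
  push_cast
  ring

/-- The row rules `hermiteLower_succ_zero` and `hermiteLower_succ_succ` lead to an expression
symmetric in `i` and `j`, so a unit can be moved from one index to the other. The boundary term
vanishes because `j < N`. -/
lemma sum_hermiteLower_succ (i : ℕ) {j N : ℕ} (hj : j < N) :
    ∑ k ∈ Finset.range N, hermiteLower (i + 1) k * hermiteDiag k * hermiteLower j k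
      = ∑ k ∈ Finset.range N, hermiteDiag (k + 1) * (hermiteLower i k * hermiteLower j (k + 1)
        + hermiteLower i (k + 1) * hermiteLower j k) := by
  obtain ⟨N, rfl⟩ : ∃ M, N = M + 1 := ⟨N - 1, by omega⟩
  simp only [mul_add]
  rw [Finset.sum_add_distrib, Finset.sum_range_succ', Finset.sum_range_succ
    (fun k => hermiteDiag (k + 1) * (hermiteLower i k * hermiteLower j (k + 1))),
    Finset.sum_range_succ'
    (fun k => hermiteDiag (k + 1) * (hermiteLower i (k + 1) * hermiteLower j k)),
    hermiteLower_of_lt hj, add_right_comm, ← add_assoc, mul_zero, mul_zero, add_zero,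
    ← Finset.sum_add_distrib]
  congr 1
  · refine Finset.sum_congr rfl fun k _ => ?_
    rw [hermiteLower_succ_succ, hermiteDiag_succ (k + 1)]
    push_cast
    ring
  · rw [hermiteLower_succ_zero, hermiteDiag_succ]
    push_cast
    ring

/-- In generating functions this is `exp (-(x + y) ^ 2) = exp (-x ^ 2) exp (-y ^ 2) exp (-2xy)`, the
last factor giving the diagonal. The proof moves units from `i` to `j` until `i = 0`. -/
lemma sum_hermiteLower (i j : ℕ) {N : ℕ} (h : i + j < N) :
    ∑ k ∈ Finset.range N, hermiteLower i k * hermiteDiag k * hermiteLower j k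
      = hermiteGauss (i + j) 0 := by
  induction i generalizing j with
  | zero =>
    rw [Finset.sum_eq_single 0]
    · simp [hermiteLower, hermiteDiag, hermiteGauss_zero_zero]
    · intro k _ hk
      rw [hermiteLower_of_lt (Nat.pos_of_ne_zero hk)]
      ring
    · intro hN
      simp at hN
      omega
  | succ i ih =>
    rw [sum_hermiteLower_succ i (by omega), add_assoc, add_comm 1 j, ← ih (j + 1) (by omega)]
    refine Eq.trans (Eq.trans ?_ (sum_hermiteLower_succ j (j := i) (N := N) (by omega)).symm) ?_ <;>
      exact Finset.sum_congr rfl fun k _ => by ring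

lemma det_hermiteGauss_zero (p : ℕ) :
    Matrix.det (Matrix.of fun i j : Fin p => hermiteGauss (i + j) 0)
      = ∏ i : Fin p, hermiteDiag i := by
  set L : Matrix (Fin p) (Fin p) ℝ := Matrix.of fun i k => hermiteLower i k with hL
  have hdet : L.det = 1 := by
    rw [Matrix.det_of_isLowerTriangular]
    · simp [hL, hermiteLower_self]
    · intro i j hij
      exact hermiteLower_of_lt hij
  have h : (Matrix.of fun i j : Fin p => hermiteGauss (i + j) 0)
      = L * Matrix.diagonal (fun k : Fin p => hermiteDiag k) * L.transpose := by
    ext i j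
    have hi := i.2
    have hj := j.2
    rw [Matrix.of_apply, ← sum_hermiteLower i j (N := 2 * p) (by omega), Matrix.mul_apply]
    simp only [Matrix.mul_diagonal, hL, Matrix.of_apply, Matrix.transpose_apply]
    rw [Fin.sum_univ_eq_sum_range
      (fun k => hermiteLower i k * hermiteDiag k * hermiteLower j k) p]
    symm
    refine Finset.sum_subset (Finset.range_subset_range.2 (by omega)) fun k _ hk => ?_
    rw [Finset.mem_range] at hk
    rw [hermiteLower_of_lt (i := i) (by omega)]
    ring
  rw [h, Matrix.det_mul, Matrix.det_mul, Matrix.det_transpose, hdet, Matrix.det_diagonal]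
  ring

lemma det_gaussDeriv_zero (p : ℕ) :
    Matrix.det (Matrix.of fun a b : Fin p => (-1) ^ (a : ℕ) * gaussDeriv (a + b) 0)
      = 2 ^ p.choose 2 * ∏ i ∈ Finset.range p, (i.factorial : ℝ) := by
  have h : (Matrix.of fun a b : Fin p => (-1) ^ (a : ℕ) * gaussDeriv (a + b) 0)
      = Matrix.of fun a b : Fin p => (-1) ^ (b : ℕ) *
        (Matrix.of fun i j : Fin p => hermiteGauss (i + j) 0) a b := by
    ext a b
    simp only [Matrix.of_apply, gaussDeriv, pow_add]
    have : ((-1 : ℝ) ^ (a : ℕ)) * (-1) ^ (a : ℕ) = 1 := by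
      rw [← mul_pow]
      simp
    linear_combination (-1) ^ (b : ℕ) * hermiteGauss (a + b) 0 * this
  rw [h, Matrix.det_mul_row, det_hermiteGauss_zero, ← Finset.prod_mul_distrib,
    Fin.prod_univ_eq_prod_range (fun b => (-1 : ℝ) ^ b * hermiteDiag b) p]
  have : ∀ b, (-1 : ℝ) ^ b * hermiteDiag b = 2 ^ b * b.factorial := by
    intro b
    rw [hermiteDiag, ← mul_assoc, ← mul_pow]
    norm_num
  simp_rw [this]
  rw [Finset.prod_mul_distrib, Finset.prod_pow_eq_pow_sum, Finset.sum_range_id,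
    Nat.choose_two_right]

/-! ### Limits and bounds for the strip determinants -/

/-- Scaled increments along two sequences with the same limit converge to the derivative. -/
lemma HasStrictFDerivAt.tendsto_mul_sub {E : Type*} [NormedAddCommGroup E] [NormedSpace ℝ E]
    {f : E → ℝ} {f' : E →L[ℝ] ℝ} {x v : E} (hf : HasStrictFDerivAt f f' x) {X Y : ℕ → E}
    {c : ℕ → ℝ} (hX : Tendsto X atTop (𝓝 x)) (hY : Tendsto Y atTop (𝓝 x))
    (hv : Tendsto (fun n => c n • (X n - Y n)) atTop (𝓝 v)) :
    Tendsto (fun n => c n * (f (X n) - f (Y n))) atTop (𝓝 (f' v)) := by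
  -- Both points move, so strict differentiability is required. The remainder `o(X n - Y n)` becomes
  -- `o(1)` after multiplication by `c n`.
  have h1 := hf.isLittleO.comp_tendsto (hX.prodMk_nhds hY)
  have h2 := (Asymptotics.isBigO_refl c atTop).smul_isLittleO h1
  have h3 := (h2.trans_isBigO (hv.isBigO_one ℝ)).tendsto_zero_of_tendsto
    (tendsto_const_nhds (x := (1 : ℝ)))
  have h4 := h3.add ((f'.continuous.tendsto v).comp hv)
  rw [zero_add] at h4
  refine h4.congr fun n => ?_
  simp only [Function.comp, map_smul, smul_eq_mul]
  ring

/-- The determinant as a function of the family of entries. -/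
noncomputable def entriesDet (p : ℕ) (M : Fin p → Fin p → ℝ) : ℝ := Matrix.det (Matrix.of M)

lemma contDiff_entriesDet (p : ℕ) : ContDiff ℝ 1 (entriesDet p) := by
  unfold entriesDet
  simp only [Matrix.det_apply, Matrix.of_apply]
  fun_prop

lemma exists_entriesDet_lipschitz (p : ℕ) (R : ℝ) : ∃ K : ℝ, 0 ≤ K ∧
    ∀ X Y : Fin p → Fin p → ℝ, ‖X‖ ≤ R → ‖Y‖ ≤ R →
      |entriesDet p X - entriesDet p Y| ≤ K * ‖X - Y‖ := by
  obtain ⟨K, hK⟩ := (contDiff_entriesDet p).contDiffOn.exists_lipschitzOnWith one_ne_zero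
    (convex_closedBall (0 : Fin p → Fin p → ℝ) R) (isCompact_closedBall _ _)
  refine ⟨K, K.2, fun X Y hX hY => ?_⟩
  simpa [dist_eq_norm] using hK.dist_le_mul X (by simpa using hX) Y (by simpa using hY)

section Limits

variable {m s : ℕ → ℤ} {t w : ℝ}

lemma tendsto_lattice_point (hm : Tendsto (fun n => (m n : ℝ) / √(n : ℝ)) atTop (𝓝 t))
    (hs : Tendsto (fun n => (s n : ℝ) / √(n : ℝ)) atTop (𝓝 w)) (l c : ℤ) :
    Tendsto (fun n => ((l * m n + c + s n : ℤ) : ℝ) / √(n : ℝ)) atTop (𝓝 (l * t + w)) := by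
  have := (tendsto_intCast_add_div_sqrt c (k := fun n => l * m n) (x := l * t) ?_).add hs
  · refine this.congr fun n => ?_
    push_cast
    ring
  · refine (hm.const_mul (l : ℝ)).congr fun n => ?_
    push_cast
    ring

lemma eventually_lattice_bounds (ht : 0 < t)
    (hm : Tendsto (fun n => (m n : ℝ) / √(n : ℝ)) atTop (𝓝 t))
    (hs : Tendsto (fun n => (s n : ℝ) / √(n : ℝ)) atTop (𝓝 w)) :
    ∀ᶠ n : ℕ in atTop, 0 < n ∧ t / 2 ≤ m n / √(n : ℝ) ∧ |(s n : ℝ) / √(n : ℝ)| ≤ |w| + 1 := by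
  filter_upwards [eventually_gt_atTop 0, hm.eventually (lt_mem_nhds (half_lt_self ht)),
    hs.abs.eventually (gt_mem_nhds (lt_add_one |w|))] with n h1 h2 h3
  exact ⟨h1, h2.le, h3.le⟩

lemma pos_of_le_div_sqrt {c : ℝ} (hc : 0 < c) {n : ℕ} {m : ℤ} (h : c ≤ m / √(n : ℝ)) : 0 < m := by
  by_contra hcon
  have : (m : ℝ) / √(n : ℝ) ≤ 0 :=
    div_nonpos_of_nonpos_of_nonneg (by exact_mod_cast not_lt.1 hcon) (Real.sqrt_nonneg _)
  linarith

lemma tendsto_periodicDiff (a : ℕ) (ht : 0 < t)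
    (hm : Tendsto (fun n => (m n : ℝ) / √(n : ℝ)) atTop (𝓝 t))
    (hs : Tendsto (fun n => (s n : ℝ) / √(n : ℝ)) atTop (𝓝 w)) :
    Tendsto (fun n => periodicDiff n a (m n) (s n)) atTop (𝓝 (gaussLatticeSum a t w)) := by
  obtain ⟨C, hC⟩ := exists_scaledDiff_lattice_bound a (half_pos ht) (|w| + 1)
  refine tendsto_tsum_of_dominated_convergence (summable_inv_one_add_abs_sq.mul_left C)
    (fun l => ?_) ?_
  · have := tendsto_scaledDiff a (tendsto_lattice_point hm hs l 0)
    simpa only [add_zero, gaussDeriv] using this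
  · filter_upwards [eventually_lattice_bounds ht hm hs] with n ⟨h1, h2, h3⟩ l
    have hm0 := pos_of_le_div_sqrt (half_pos ht) h2
    exact abs_le_of_one_add_abs_mul_le (hC n l (m n) _ _ h1 h2 h3 (by rw [abs_mul, abs_of_pos hm0]))

lemma sqrt_mul_periodicDiff_sub (n a : ℕ) {m : ℤ} (hm : 0 < m) (s : ℤ) :
    √(n : ℝ) * (periodicDiff n a (m + 1) s - periodicDiff n a m s)
      = ∑' l : ℤ, √(n : ℝ) * (scaledDiff n a (l * (m + 1) + s) - scaledDiff n a (l * m + s)) := by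
  rw [periodicDiff, periodicDiff, tsum_mul_left,
    (summable_scaledDiff n a (by omega) s).tsum_sub (summable_scaledDiff n a hm s)]

lemma sign_mul_natAbs_cast (l : ℤ) : (l.sign : ℝ) * (l.natAbs : ℝ) = l := by
  rw [Nat.cast_natAbs]
  exact_mod_cast Int.sign_mul_abs l

lemma tendsto_sqrt_mul_periodicDiff_sub (a : ℕ) (ht : 0 < t)
    (hm : Tendsto (fun n => (m n : ℝ) / √(n : ℝ)) atTop (𝓝 t))
    (hs : Tendsto (fun n => (s n : ℝ) / √(n : ℝ)) atTop (𝓝 w)) :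
    Tendsto (fun n : ℕ => √(n : ℝ) * (periodicDiff n a (m n + 1) (s n)
      - periodicDiff n a (m n) (s n))) atTop (𝓝 (gaussLatticeSumDeriv a t w)) := by
  obtain ⟨C, hC⟩ := exists_scaledDiff_sub_bound a (half_pos ht) (|w| + 1)
  have key : Tendsto (fun n : ℕ => ∑' l : ℤ, √(n : ℝ) * (scaledDiff n a (l * (m n + 1) + s n)
      - scaledDiff n a (l * m n + s n))) atTop (𝓝 (gaussLatticeSumDeriv a t w)) := by
    refine tendsto_tsum_of_dominated_convergence (summable_inv_one_add_abs_sq.mul_left C)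
      (fun l => ?_) ?_
    · simp_rw [sqrt_mul_scaledDiff_sub]
      have h1 : Tendsto (fun n => ∑ u ∈ Finset.range l.natAbs,
          scaledDiff n (a + 1) (l * m n + min l 0 + u + s n)) atTop
          (𝓝 (∑ u ∈ Finset.range l.natAbs, gaussDeriv (a + 1) (l * t + w))) := by
        refine tendsto_finsetSum _ fun u _ => ?_
        have := tendsto_scaledDiff (a + 1) (tendsto_lattice_point hm hs l (min l 0 + u))
        simpa only [← add_assoc, gaussDeriv] using this
      convert h1.const_mul (l.sign : ℝ) using 2
      rw [Finset.sum_const, Finset.card_range, nsmul_eq_mul, ← mul_assoc, sign_mul_natAbs_cast]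
    · filter_upwards [eventually_lattice_bounds ht hm hs] with n ⟨h1, h2, h3⟩ l
      exact hC n l (m n) _ h1 h2 h3
  refine key.congr' ?_
  filter_upwards [eventually_lattice_bounds ht hm hs] with n ⟨h1, h2, h3⟩
  rw [sqrt_mul_periodicDiff_sub n a (pos_of_le_div_sqrt (half_pos ht) h2)]

end Limits

lemma exists_periodicDiff_bound (a : ℕ) {c : ℝ} (hc : 0 < c) (R : ℝ) : ∃ C : ℝ,
    ∀ (n : ℕ) (m s : ℤ), 0 < n → c ≤ m / √(n : ℝ) → |(s : ℝ) / √(n : ℝ)| ≤ R →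
      |periodicDiff n a m s| ≤ C := by
  obtain ⟨C, hC⟩ := exists_scaledDiff_lattice_bound a hc R
  refine ⟨∑' l : ℤ, C * (1 / (1 + |(l : ℝ)|) ^ 2), fun n m s hn hm hs => ?_⟩
  rw [periodicDiff, ← Real.norm_eq_abs]
  refine tsum_of_norm_bounded (summable_inv_one_add_abs_sq.mul_left C).hasSum fun l => ?_
  have hm0 := pos_of_le_div_sqrt hc hm
  exact abs_le_of_one_add_abs_mul_le (hC n l m _ _ hn hm hs (by rw [abs_mul, abs_of_pos hm0]))

lemma exists_periodicDiff_sub_bound (a : ℕ) {c : ℝ} (hc : 0 < c) (R : ℝ) : ∃ C : ℝ,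
    ∀ (n : ℕ) (m s : ℤ), 0 < n → c ≤ m / √(n : ℝ) → |(s : ℝ) / √(n : ℝ)| ≤ R →
      |√(n : ℝ) * (periodicDiff n a (m + 1) s - periodicDiff n a m s)| ≤ C := by
  obtain ⟨C, hC⟩ := exists_scaledDiff_sub_bound a hc R
  refine ⟨∑' l : ℤ, C * (1 / (1 + |(l : ℝ)|) ^ 2), fun n m s hn hm hs => ?_⟩
  rw [sqrt_mul_periodicDiff_sub n a (pos_of_le_div_sqrt hc hm), ← Real.norm_eq_abs]
  exact tsum_of_norm_bounded (summable_inv_one_add_abs_sq.mul_left C).hasSum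
    fun l => hC n l m s hn hm hs

/-- The limits of the rescaled strip entries. -/
noncomputable def limitEntry {p : ℕ} (z w : ℝ) (a b : Fin p) : ℝ :=
  (-1) ^ (a : ℕ) * gaussLatticeSum (a + b) z 0 - gaussLatticeSum (a + b) z w

/-- The derivatives of the limit entries with respect to the width. -/
noncomputable def limitEntryDeriv {p : ℕ} (z w : ℝ) (a b : Fin p) : ℝ :=
  (-1) ^ (a : ℕ) * gaussLatticeSumDeriv (a + b) z 0 - gaussLatticeSumDeriv (a + b) z w

/-- Replacing Hermite functions by Gaussian derivatives multiplies entry `(a, b)` by `(-1) ^ (a +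
b)`. The row signs and the column signs have the same product, so they cancel in the determinant. -/
lemma rangeDet_eq (p : ℕ) (z w : ℝ) : rangeDet p z w = entriesDet p (limitEntry z w) := by
  have hsum : ∀ (a : ℕ) (w : ℝ), gaussLatticeSum a z w
      = (-1) ^ a * ∑' l : ℤ, hermiteGauss a (l * z + w) := fun a w => by
    simp only [gaussLatticeSum, gaussDeriv, tsum_mul_left]
  have hsq : (∏ i : Fin p, (-1 : ℝ) ^ (i : ℕ)) * ∏ i : Fin p, (-1 : ℝ) ^ (i : ℕ) = 1 := by
    rw [← Finset.prod_mul_distrib]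
    refine Finset.prod_eq_one fun i _ => ?_
    rw [← mul_pow]
    simp
  have hone : ∀ M : Matrix (Fin p) (Fin p) ℝ, M.det = (∏ i : Fin p, (-1 : ℝ) ^ (i : ℕ)) *
      ((∏ i : Fin p, (-1 : ℝ) ^ (i : ℕ)) * M.det) := fun M => by rw [← mul_assoc, hsq, one_mul]
  rw [rangeDet, hone, ← Matrix.det_mul_row, ← Matrix.det_mul_column, entriesDet]
  congr 1
  ext a b
  simp only [Matrix.of_apply, limitEntry, hsum, pow_add, add_zero]
  ring

lemma rangeDet_hasDerivAt (p : ℕ) {t : ℝ} (ht : 0 < t) (w : ℝ) :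
    HasDerivAt (fun z => rangeDet p z w)
      (fderiv ℝ (entriesDet p) (limitEntry t w) (limitEntryDeriv t w)) t := by
  simp_rw [rangeDet_eq]
  have h1 := ((contDiff_entriesDet p).differentiable one_ne_zero
    (limitEntry t w)).hasFDerivAt
  refine HasFDerivAt.comp_hasDerivAt (f := fun z => limitEntry z w) t h1 ?_
  rw [hasDerivAt_pi]
  intro a
  rw [hasDerivAt_pi]
  intro b
  exact ((gaussLatticeSum_hasDerivAt (a + b) ht 0).const_mul _).sub
    (gaussLatticeSum_hasDerivAt (a + b) ht w)

section StripLimits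

variable {p : ℕ} {m s : ℕ → ℤ} {t w : ℝ}

lemma tendsto_intCast_const_div_sqrt (c : ℤ) :
    Tendsto (fun n : ℕ => (c : ℝ) / √(n : ℝ)) atTop (𝓝 0) :=
  tendsto_natCast_sqrt.const_div_atTop _

lemma tendsto_stripEntry (ht : 0 < t)
    (hm : Tendsto (fun n => (m n : ℝ) / √(n : ℝ)) atTop (𝓝 t))
    (hs : Tendsto (fun n => (s n : ℝ) / √(n : ℝ)) atTop (𝓝 w)) :
    Tendsto (fun n => stripEntry (p := p) n (m n) (s n)) atTop (𝓝 (limitEntry t w)) := by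
  rw [tendsto_pi_nhds]
  intro a
  rw [tendsto_pi_nhds]
  intro b
  exact ((tendsto_periodicDiff (a + b) ht hm (tendsto_intCast_const_div_sqrt _)).const_mul _).sub
    (tendsto_periodicDiff (a + b) ht hm hs)

lemma tendsto_sqrt_smul_stripEntry_sub (ht : 0 < t)
    (hm : Tendsto (fun n => (m n : ℝ) / √(n : ℝ)) atTop (𝓝 t))
    (hs : Tendsto (fun n => (s n : ℝ) / √(n : ℝ)) atTop (𝓝 w)) :
    Tendsto (fun n : ℕ => √(n : ℝ) • (stripEntry (p := p) n (m n + 1) (s n)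
      - stripEntry n (m n) (s n))) atTop (𝓝 (limitEntryDeriv t w)) := by
  rw [tendsto_pi_nhds]
  intro a
  rw [tendsto_pi_nhds]
  intro b
  have h := ((tendsto_sqrt_mul_periodicDiff_sub (a + b : ℕ) ht hm
    (tendsto_intCast_const_div_sqrt (-(a : ℤ)))).const_mul ((-1) ^ (a : ℕ))).sub
    (tendsto_sqrt_mul_periodicDiff_sub (a + b : ℕ) ht hm hs)
  refine h.congr fun n => ?_
  simp only [Pi.smul_apply, Pi.sub_apply, smul_eq_mul, stripEntry]
  ring

lemma tendsto_sqrt_mul_entriesDet_sub (ht : 0 < t)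
    (hm : Tendsto (fun n => (m n : ℝ) / √(n : ℝ)) atTop (𝓝 t))
    (hs : Tendsto (fun n => (s n : ℝ) / √(n : ℝ)) atTop (𝓝 w)) :
    Tendsto (fun n : ℕ => √(n : ℝ) * (entriesDet p (stripEntry n (m n + 1) (s n))
      - entriesDet p (stripEntry n (m n) (s n)))) atTop
      (𝓝 (deriv (fun z => rangeDet p z w) t)) := by
  rw [(rangeDet_hasDerivAt p ht w).deriv]
  exact HasStrictFDerivAt.tendsto_mul_sub
    ((contDiff_entriesDet p).contDiffAt.hasStrictFDerivAt one_ne_zero)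
    (tendsto_stripEntry ht (tendsto_intCast_add_div_sqrt 1 hm) hs) (tendsto_stripEntry ht hm hs)
    (tendsto_sqrt_smul_stripEntry_sub ht hm hs)

end StripLimits

lemma le_sum_abs_of_mem {q : ℕ} (C : ℕ → ℝ) {a : ℕ} (ha : a < q) {x : ℝ} (hx : x ≤ C a) :
    x ≤ ∑ i ∈ Finset.range q, |C i| :=
  hx.trans ((le_abs_self _).trans (Finset.single_le_sum (f := fun i => |C i|)
    (fun _ _ => abs_nonneg _) (Finset.mem_range.2 ha)))

lemma abs_neg_natCast_div_sqrt_le {p n : ℕ} (hn : 0 < n) (a : Fin p) :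
    |((-(a : ℤ) : ℤ) : ℝ) / √(n : ℝ)| ≤ p := by
  have hs := sqrt_natCast_one_le hn
  have ha : ((a : ℕ) : ℝ) ≤ p := by exact_mod_cast a.2.le
  push_cast
  rw [abs_div, abs_neg, abs_of_nonneg (Real.sqrt_nonneg _), abs_of_nonneg (Nat.cast_nonneg _)]
  exact (div_le_self (Nat.cast_nonneg _) hs).trans ha

lemma exists_stripEntry_bound (p : ℕ) {c : ℝ} (hc : 0 < c) (R : ℝ) : ∃ C : ℝ,
    ∀ (n : ℕ) (m s : ℤ), 0 < n → c ≤ m / √(n : ℝ) → |(s : ℝ) / √(n : ℝ)| ≤ R →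
      ‖stripEntry (p := p) n m s‖ ≤ C := by
  choose C₁ h₁ using fun a => exists_periodicDiff_bound a hc (p : ℝ)
  choose C₂ h₂ using fun a => exists_periodicDiff_bound a hc R
  refine ⟨(∑ i ∈ Finset.range (2 * p), |C₁ i|) + ∑ i ∈ Finset.range (2 * p), |C₂ i|,
    fun n m s hn hm hs => ?_⟩
  rw [pi_norm_le_iff_of_nonneg (by positivity)]
  intro a
  rw [pi_norm_le_iff_of_nonneg (by positivity)]
  intro b
  have hab : (a + b : ℕ) < 2 * p := by omega
  refine (norm_sub_le _ _).trans (add_le_add ?_ ?_)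
  · rw [norm_mul, norm_pow, norm_neg, norm_one, one_pow, one_mul]
    exact le_sum_abs_of_mem C₁ hab (h₁ _ n m _ hn hm (abs_neg_natCast_div_sqrt_le hn a))
  · exact le_sum_abs_of_mem C₂ hab (h₂ _ n m _ hn hm hs)

lemma exists_stripEntry_sub_bound (p : ℕ) {c : ℝ} (hc : 0 < c) (R : ℝ) : ∃ C : ℝ,
    ∀ (n : ℕ) (m s : ℤ), 0 < n → c ≤ m / √(n : ℝ) → |(s : ℝ) / √(n : ℝ)| ≤ R →
      √(n : ℝ) * ‖stripEntry (p := p) n (m + 1) s - stripEntry n m s‖ ≤ C := by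
  choose C₁ h₁ using fun a => exists_periodicDiff_sub_bound a hc (p : ℝ)
  choose C₂ h₂ using fun a => exists_periodicDiff_sub_bound a hc R
  refine ⟨(∑ i ∈ Finset.range (2 * p), |C₁ i|) + ∑ i ∈ Finset.range (2 * p), |C₂ i|,
    fun n m s hn hm hs => ?_⟩
  have hnorm : √(n : ℝ) * ‖stripEntry (p := p) n (m + 1) s - stripEntry n m s‖
      = ‖√(n : ℝ) • (stripEntry (p := p) n (m + 1) s - stripEntry n m s)‖ := by
    rw [norm_smul, Real.norm_of_nonneg (Real.sqrt_nonneg _)]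
  rw [hnorm, pi_norm_le_iff_of_nonneg (by positivity)]
  intro a
  rw [pi_norm_le_iff_of_nonneg (by positivity)]
  intro b
  have hab : (a + b : ℕ) < 2 * p := by omega
  have e : (√(n : ℝ) • (stripEntry (p := p) n (m + 1) s - stripEntry n m s) :
        Fin p → Fin p → ℝ) a b
      = (-1) ^ (a : ℕ) * (√(n : ℝ) * (periodicDiff n (a + b) (m + 1) (-(a : ℤ))
        - periodicDiff n (a + b) m (-(a : ℤ))))
        - √(n : ℝ) * (periodicDiff n (a + b) (m + 1) s - periodicDiff n (a + b) m s) := by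
    simp only [Pi.smul_apply, Pi.sub_apply, smul_eq_mul, stripEntry]
    ring
  rw [e]
  refine (norm_sub_le _ _).trans (add_le_add ?_ ?_)
  · rw [norm_mul, norm_pow, norm_neg, norm_one, one_pow, one_mul]
    exact le_sum_abs_of_mem C₁ hab (h₁ _ n m _ hn hm (abs_neg_natCast_div_sqrt_le hn a))
  · exact le_sum_abs_of_mem C₂ hab (h₂ _ n m _ hn hm hs)

/-- The entries stay in a fixed ball, where the determinant is Lipschitz. This supplies the
dominating constant for the sum over `s`. -/
lemma exists_entriesDet_sub_bound (p : ℕ) {c : ℝ} (hc : 0 < c) (R : ℝ) : ∃ C : ℝ,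
    ∀ (n : ℕ) (m s : ℤ), 0 < n → c ≤ m / √(n : ℝ) → |(s : ℝ) / √(n : ℝ)| ≤ R →
      |√(n : ℝ) * (entriesDet p (stripEntry n (m + 1) s) - entriesDet p (stripEntry n m s))|
        ≤ C := by
  obtain ⟨C, hC⟩ := exists_stripEntry_bound p hc R
  obtain ⟨C', hC'⟩ := exists_stripEntry_sub_bound p hc R
  obtain ⟨K, hK0, hK⟩ := exists_entriesDet_lipschitz p C
  refine ⟨K * C', fun n m s hn hm hs => ?_⟩
  have hm' : c ≤ ((m + 1 : ℤ) : ℝ) / √(n : ℝ) := by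
    refine hm.trans ?_
    gcongr
    simp
  have h := hK _ _ (hC n (m + 1) s hn hm' hs) (hC n m s hn hm hs)
  rw [abs_mul, abs_of_nonneg (Real.sqrt_nonneg _)]
  calc _ ≤ √(n : ℝ) * (K * ‖stripEntry (p := p) n (m + 1) s - stripEntry n m s‖) := by gcongr
    _ = K * (√(n : ℝ) * ‖stripEntry (p := p) n (m + 1) s - stripEntry n m s‖) := by ring
    _ ≤ _ := by
      gcongr
      exact hC' n m s hn hm hs

/-! ### Riemann sums on the grid of mesh `1 / √n` -/

/-- The step function on the grid of mesh `1 / √n` whose integral is `∑ s ≤ M, F s`. -/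
noncomputable def gridStep (n M : ℕ) (F : ℤ → ℝ) (w : ℝ) : ℝ :=
  ∑ s ∈ Finset.range (M + 1),
    (Set.Ico ((s : ℝ) / √(n : ℝ)) ((s + 1) / √(n : ℝ))).indicator (fun _ => √(n : ℝ) * F s) w

lemma measurable_gridStep (n M : ℕ) (F : ℤ → ℝ) : Measurable (gridStep n M F) := by
  unfold gridStep
  exact Finset.measurable_sum _ fun s _ => measurable_const.indicator measurableSet_Ico

lemma integral_gridStep {n : ℕ} (hn : 0 < n) (M : ℕ) (F : ℤ → ℝ) :
    ∫ w, gridStep n M F w = ∑ s ∈ Finset.range (M + 1), F s := by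
  have hs : 0 < √(n : ℝ) := Real.sqrt_pos.2 (by exact_mod_cast hn)
  unfold gridStep
  rw [MeasureTheory.integral_finsetSum]
  · refine Finset.sum_congr rfl fun s _ => ?_
    rw [MeasureTheory.integral_indicator measurableSet_Ico, MeasureTheory.setIntegral_const,
      Real.volume_real_Ico_of_le (by gcongr; linarith), smul_eq_mul]
    field_simp
    ring
  · intro s _
    rw [MeasureTheory.integrable_indicator_iff measurableSet_Ico]
    exact MeasureTheory.integrableOn_const (by simp)

lemma gridStep_eq {n : ℕ} (hn : 0 < n) (M : ℕ) (F : ℤ → ℝ) (w : ℝ) :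
    gridStep n M F w = if 0 ≤ w ∧ ⌊w * √(n : ℝ)⌋ ≤ M then √(n : ℝ) * F ⌊w * √(n : ℝ)⌋ else 0 := by
  have hs : 0 < √(n : ℝ) := Real.sqrt_pos.2 (by exact_mod_cast hn)
  have hmem : ∀ s : ℕ, w ∈ Set.Ico ((s : ℝ) / √(n : ℝ)) ((s + 1) / √(n : ℝ)) ↔
      ⌊w * √(n : ℝ)⌋ = s := by
    intro s
    rw [Int.floor_eq_iff, Set.mem_Ico, div_le_iff₀ hs, lt_div_iff₀ hs]
    push_cast
    rfl
  unfold gridStep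
  simp only [Set.indicator_apply, hmem]
  split_ifs with h
  · have h0 : 0 ≤ ⌊w * √(n : ℝ)⌋ := Int.floor_nonneg.2 (mul_nonneg h.1 hs.le)
    obtain ⟨k, hk⟩ := Int.eq_ofNat_of_zero_le h0
    rw [hk] at h ⊢
    rw [Finset.sum_eq_single k]
    · simp
    · intro b _ hb
      rw [if_neg]
      exact fun h => hb (by exact_mod_cast h.symm)
    · intro hkM
      simp only [Finset.mem_range] at hkM
      omega
  · refine Finset.sum_eq_zero fun s hsM => if_neg fun hcon => h ?_
    rw [Finset.mem_range] at hsM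
    refine ⟨?_, by omega⟩
    have : (0 : ℤ) ≤ ⌊w * √(n : ℝ)⌋ := by omega
    rw [Int.floor_nonneg] at this
    exact nonneg_of_mul_nonneg_left this hs

/-- Convergence of Riemann-type sums with bounded, pointwise convergent terms. -/
lemma tendsto_sum_of_tendsto_floor {F : ℕ → ℤ → ℝ} {M : ℕ → ℕ} {t C : ℝ} {g : ℝ → ℝ} (ht : 0 < t)
    (hM : Tendsto (fun n => (M n : ℝ) / √(n : ℝ)) atTop (𝓝 t))
    (hF : ∀ᶠ n : ℕ in atTop, ∀ s : ℤ, 0 ≤ s → s ≤ M n → |√(n : ℝ) * F n s| ≤ C)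
    (hg : ∀ w ∈ Set.Ioo 0 t,
      Tendsto (fun n : ℕ => √(n : ℝ) * F n ⌊w * √(n : ℝ)⌋) atTop (𝓝 (g w))) :
    IntervalIntegrable g MeasureTheory.volume 0 t ∧
      Tendsto (fun n => ∑ s ∈ Finset.range (M n + 1), F n s) atTop (𝓝 (∫ w in (0 : ℝ)..t, g w)) := by
  set φ : ℕ → ℝ → ℝ := fun n => gridStep n (M n) (F n) with hφ
  set G : ℝ → ℝ := (Set.Ioc 0 t).indicator g with hG
  -- The last grid cell ends at `(M n + 1) / √n`, possibly beyond `t`; the interval up to `t + 1`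
  -- eventually contains it.
  set B : ℝ → ℝ := (Set.Icc 0 (t + 1)).indicator (fun _ => C) with hB
  have hM1 : Tendsto (fun n => ((M n : ℝ) + 1) / √(n : ℝ)) atTop (𝓝 t) := by
    have := tendsto_intCast_add_div_sqrt (k := fun n => (M n : ℤ)) 1 (by simpa using hM)
    simpa using this
  have hlim : ∀ᵐ w, Tendsto (fun n => φ n w) atTop (𝓝 (G w)) := by
    have h0 : ∀ᵐ w : ℝ, w ≠ t := by simp [MeasureTheory.ae_iff]
    have h1 : ∀ᵐ w : ℝ, w ≠ 0 := by simp [MeasureTheory.ae_iff]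
    filter_upwards [h0, h1] with w hwt hw0
    rcases lt_or_gt_of_ne hw0 with hw | hw
    · rw [hG, Set.indicator_of_notMem (fun h => absurd h.1 hw.not_gt)]
      refine tendsto_const_nhds.congr' ?_
      filter_upwards [eventually_gt_atTop 0] with n hn
      simp only [hφ]
      rw [gridStep_eq hn, if_neg (fun h => absurd h.1 hw.not_ge)]
    · rcases lt_or_gt_of_ne hwt with hlt | hgt
      · rw [hG, Set.indicator_of_mem (Set.mem_Ioc.2 ⟨hw, hlt.le⟩)]
        refine (hg w ⟨hw, hlt⟩).congr' ?_
        filter_upwards [eventually_gt_atTop 0, hM.eventually (lt_mem_nhds hlt)] with n hn h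
        have hs : 0 < √(n : ℝ) := Real.sqrt_pos.2 (by exact_mod_cast hn)
        rw [lt_div_iff₀ hs] at h
        have h' : ⌊w * √(n : ℝ)⌋ ≤ M n := by
          have := Int.floor_le_floor h.le
          rwa [Int.floor_natCast] at this
        simp only [hφ]
        rw [gridStep_eq hn, if_pos ⟨hw.le, h'⟩]
      · rw [hG, Set.indicator_of_notMem (fun h => absurd h.2 hgt.not_ge)]
        refine tendsto_const_nhds.congr' ?_
        filter_upwards [eventually_gt_atTop 0, hM1.eventually (gt_mem_nhds hgt)] with n hn h
        have hs : 0 < √(n : ℝ) := Real.sqrt_pos.2 (by exact_mod_cast hn)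
        rw [div_lt_iff₀ hs] at h
        simp only [hφ]
        rw [gridStep_eq hn, if_neg]
        rintro ⟨-, h'⟩
        have h2 := Int.lt_floor_add_one (w * √(n : ℝ))
        have h3 : (⌊w * √(n : ℝ)⌋ : ℝ) ≤ M n := by exact_mod_cast h'
        linarith
  have hbound : ∀ᶠ n in atTop, ∀ w, ‖φ n w‖ ≤ B w := by
    filter_upwards [eventually_gt_atTop 0, hF, hM1.eventually (gt_mem_nhds (lt_add_one t))]
      with n hn hFn hMn w
    have hs : 0 < √(n : ℝ) := Real.sqrt_pos.2 (by exact_mod_cast hn)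
    have hC : 0 ≤ C := (abs_nonneg _).trans (hFn 0 le_rfl (by positivity))
    simp only [hφ]
    rw [gridStep_eq hn]
    split_ifs with h
    · have hw : w ∈ Set.Icc 0 (t + 1) := by
        refine ⟨h.1, ?_⟩
        have h2 := Int.lt_floor_add_one (w * √(n : ℝ))
        have h3 : (⌊w * √(n : ℝ)⌋ : ℝ) ≤ M n := by exact_mod_cast h.2
        have h4 : w ≤ ((M n : ℝ) + 1) / √(n : ℝ) := by
          rw [le_div_iff₀ hs]
          linarith
        linarith
      rw [hB, Set.indicator_of_mem hw]
      exact hFn _ (Int.floor_nonneg.2 (mul_nonneg h.1 hs.le)) h.2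
    · rw [norm_zero]
      exact Set.indicator_nonneg (fun _ _ => hC) _
  have hBint : MeasureTheory.Integrable B := by
    rw [hB, MeasureTheory.integrable_indicator_iff measurableSet_Icc]
    exact MeasureTheory.integrableOn_const (by simp)
  -- Measurability of `g` is not assumed; it is inherited from the step functions, which converge
  -- almost everywhere.
  have hGm : MeasureTheory.AEStronglyMeasurable G MeasureTheory.volume :=
    aestronglyMeasurable_of_tendsto_ae atTop
      (fun n => (measurable_gridStep n (M n) (F n)).aestronglyMeasurable) hlim
  have hGint : MeasureTheory.Integrable G := by
    refine hBint.mono' hGm ?_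
    filter_upwards [hlim] with w hw
    exact le_of_tendsto hw.norm (hbound.mono fun n h => h w)
  refine ⟨?_, ?_⟩
  · rw [intervalIntegrable_iff_integrableOn_Ioc_of_le ht.le,
      ← MeasureTheory.integrable_indicator_iff measurableSet_Ioc]
    exact hGint
  · have h := MeasureTheory.tendsto_integral_filter_of_dominated_convergence B
      (Eventually.of_forall fun n => (measurable_gridStep n (M n) (F n)).aestronglyMeasurable)
      (hbound.mono fun n h => Eventually.of_forall h) hBint hlim
    rw [hG, MeasureTheory.integral_indicator measurableSet_Ioc,
      ← intervalIntegral.integral_of_le ht.le] at h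
    refine h.congr' ?_
    filter_upwards [eventually_gt_atTop 0] with n hn
    exact integral_gridStep hn _ _

/-! ### Conclusion -/

lemma summable_hermiteGauss (a : ℕ) {z : ℝ} (hz : 0 < z) (w : ℝ) :
    Summable fun l : ℤ => hermiteGauss a (l * z + w) := by
  refine ((summable_gaussDeriv a hz w).mul_left ((-1) ^ a)).congr fun l => ?_
  rw [gaussDeriv, ← mul_assoc, ← mul_pow]
  simp

lemma tendsto_stripScale_mul_card {p : ℕ} (hp : 0 < p) :
    Tendsto (fun n => stripScale p n * (watermelonFinset p n).card) atTop
      (𝓝 (2 ^ p.choose 2 * ∏ i ∈ Finset.range p, (i.factorial : ℝ))) := by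
  simp_rw [stripScale_mul_card_watermelonFinset hp]
  rw [← det_gaussDeriv_zero]
  refine ((contDiff_entriesDet p).continuous.tendsto _).comp ?_
  rw [tendsto_pi_nhds]
  intro a
  rw [tendsto_pi_nhds]
  intro b
  exact (tendsto_scaledDiff _ (tendsto_intCast_const_div_sqrt _)).const_mul _

theorem mainTheorem3 (p : ℕ) (hp : 0 < p) (t : ℝ) (ht : 0 < t) :
    (∀ (a : ℕ) (z w : ℝ), 0 < z → Summable fun l : ℤ => hermiteGauss a (l * z + w)) ∧
    (∀ w : ℝ, DifferentiableAt ℝ (fun z => rangeDet p z w) t) ∧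
    IntervalIntegrable (fun w => deriv (fun z => rangeDet p z w) t) MeasureTheory.volume 0 t ∧
    Tendsto
      (fun n : ℕ => (watermelonMeasure p n).real
        {W | ((watermelonRange hp W : ℝ) + 1) / √(n : ℝ) ≤ t})
      atTop
      (𝓝 (((2 : ℝ) ^ p.choose 2)⁻¹ / (∏ i ∈ Finset.range p, (i.factorial : ℝ)) *
        ∫ w in (0 : ℝ)..t, deriv (fun z => rangeDet p z w) t)) := by
  set M : ℕ → ℕ := fun n => ⌊t * √(n : ℝ)⌋.toNat with hMdef
  have hMfloor : ∀ n, (M n : ℤ) = ⌊t * √(n : ℝ)⌋ := fun n =>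
    Int.toNat_of_nonneg (Int.floor_nonneg.2 (mul_nonneg ht.le (Real.sqrt_nonneg _)))
  have hMZ : Tendsto (fun n => ((M n : ℤ) : ℝ) / √(n : ℝ)) atTop (𝓝 t) := by
    simp_rw [hMfloor]
    exact tendsto_floor_mul_sqrt_div t
  have hM : Tendsto (fun n => (M n : ℝ) / √(n : ℝ)) atTop (𝓝 t) := by simpa using hMZ
  set F : ℕ → ℤ → ℝ := fun n s => entriesDet p (stripEntry n (M n + 1) s)
    - entriesDet p (stripEntry n (M n) s) with hFdef
  obtain ⟨C, hC⟩ := exists_entriesDet_sub_bound p (half_pos ht) (t + 1)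
  have hev : ∀ᶠ n : ℕ in atTop, 0 < n ∧ t / 2 ≤ (M n : ℤ) / √(n : ℝ) ∧
      (M n : ℝ) / √(n : ℝ) ≤ t + 1 := by
    filter_upwards [eventually_gt_atTop 0, hMZ.eventually (lt_mem_nhds (half_lt_self ht)),
      hM.eventually (gt_mem_nhds (lt_add_one t))] with n h1 h2 h3
    exact ⟨h1, h2.le, h3.le⟩
  obtain ⟨hint, hsum⟩ := tendsto_sum_of_tendsto_floor (F := F) (C := C)
    (g := fun w => deriv (fun z => rangeDet p z w) t) ht hM
    (by
      filter_upwards [hev] with n ⟨h1, h2, h3⟩ s hs0 hsM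
      refine hC n (M n) s h1 h2 (le_trans ?_ h3)
      have hs0' : (0 : ℝ) ≤ s := by exact_mod_cast hs0
      rw [abs_of_nonneg (by positivity)]
      gcongr
      exact_mod_cast hsM)
    (fun w _ => tendsto_sqrt_mul_entriesDet_sub ht hMZ (tendsto_floor_mul_sqrt_div w))
  refine ⟨fun a z w hz => summable_hermiteGauss a hz w,
    fun w => (rangeDet_hasDerivAt p ht w).differentiableAt, hint, ?_⟩
  have hne : (2 : ℝ) ^ p.choose 2 * ∏ i ∈ Finset.range p, (i.factorial : ℝ) ≠ 0 := by positivity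
  -- Numerator and denominator of the probability carry the same factor `stripScale p n`, which
  -- cancels.
  have hquot := hsum.div (tendsto_stripScale_mul_card hp) hne
  convert hquot.congr' ?_ using 2
  · rw [inv_eq_one_div, div_div, div_mul_eq_mul_div, one_mul]
  · filter_upwards [hev] with n ⟨h1, h2, _⟩
    have hM0 : 0 < M n := by exact_mod_cast pos_of_le_div_sqrt (half_pos ht) h2
    rw [watermelonMeasure_real_range_le hp h1, ← hMfloor, card_watermelonRange_lt hp n hM0,
      ← mul_div_mul_left _ _ (stripScale_pos p h1).ne', Finset.mul_sum]
    simp only [Pi.div_apply]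
    congr 1
    refine Finset.sum_congr rfl fun s _ => ?_
    rw [mul_sub, stripScale_mul_stripDet p n (by omega), stripScale_mul_stripDet p n (by omega)]
    rfl
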